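/- Let $q$ be a prime power, let $k\ge 0$ and $n\ge 2k+1$ be integers, and let $\mathrm{PG}(n,q)$ be the $n$-dimensional projective space over $\mathbb F_q$; all dimensions are projective and a $(-1)$-space is empty. Write $\begin{bmatrix}a\\b\end{bmatrix}=\prod_{t=0}^{b-1}\frac{q^{a-t}-1}{q^{t+1}-1}$ for the Gaussian binomial coefficient. Let $\Pi_k$ be the set of $k$-spaces, $j\in\mathbb R^{\Pi_k}$ the all-one vector, and $A$ the real $0/1$ incidence matrix with rows indexed by the points and columns indexed by the $k$-spaces. For $0\le i\le k+1$ let $A_i$ be the $0/1$ matrix on $\Pi_k$ of the relation $\dim(\pi\cap\pi')=k-i$, and let $V_0,\dots,V_{k+1}$ be the common eigenspaces of the Grassmann scheme in the usual ordering: $V_r=\{v\in\mathbb R^{\Pi_k}: A_iv=P_{ri}v \text{ for } 0\le i\le k+1\}$ with $$P_{ri}=\sum_{s=\max(0,r-i)}^{\min(r,k+1-i)}(-1)^{r+s}\begin{bmatrix}r\\s\end{bmatrix}\begin{bmatrix}n-k+s-r\\n-k-i\end{bmatrix}\begin{bmatrix}k+1-s\\i\end{bmatrix}q^{\,i(i+s-r)+\frac{(r-s)(r-s-1)}{2}}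 .$$ A partial $k$-spread is a set of pairwise disjoint $k$-spaces; a $k$-spread is a partial $k$-spread that partitions the point set. A pair of conjugate switching sets consists of two partial $k$-spreads without common members that cover the same set of points. Let $\mathcal L$ be a non-empty set of $k$-spaces with characteristic vector $\chi\in\mathbb R^{\Pi_k}$, and let $x\in\mathbb R$ be such that $|\mathcal L|=x\begin{bmatrix}n\\k\end{bmatrix}$. Then, for each fixed $i\in\{1,\dots,k+1\}$, the following properties are equivalent. 1. $\chi\in\operatorname{im}(A^T)$. 2. $\chi\in(\ker A)^\perp$. 3. For every $k$-space $\pi$, exactly $(x-\chi(\pi))\begin{bmatrix}n-k-1\\k\end{bmatrix}q^{k^2+k}$ elements of $\mathcal L$ are disjoint from $\pi$. 4. $\chi-x\frac{q^{k+1}-1}{q^{n+1}-1}\,j\in V_1$. 5. $\chi\in V_0\perp V_1$ (the orthogonal sum of $V_0$ and $V_1$). 6. For every $k$-space $\pi$, the number of elements of $\mathcal L$ meeting $\pi$ in a $(k-i)$-space is $$\left((x-1)\frac{q^{k+1}-1}{q^{k-i+1}-1}+q^i\frac{q^{n-k}-1}{q^i-1}\right)q^{i(i-1)}\begin{bmatrix}n-k-1\\i-1\end{bmatrix}\begin{bmatrix}k\\i\end{bmatrix}\quad\text{if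 }\pi\in\mathcal L,$$ which for $i=k+1$ is to be read as $(x-1)\,q^{k(k+1)}\begin{bmatrix}n-k-1\\k\end{bmatrix}$, and $$x\begin{bmatrix}n-k-1\\i-1\end{bmatrix}\begin{bmatrix}k+1\\i\end{bmatrix}q^{i(i-1)}\quad\text{if }\pi\notin\mathcal L.$$ 7. $|\mathcal L\cap\mathcal R|=|\mathcal L\cap\mathcal R'|$ for every pair of conjugate switching sets $\mathcal R,\mathcal R'$. If $\mathrm{PG}(n,q)$ has a $k$-spread, then these properties are also equivalent to: 8. $|\mathcal L\cap\mathcal S|=x$ for every $k$-spread $\mathcal S$ of $\mathrm{PG}(n,q)$. -/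

import Mathlib

/-- The Gaussian binomial coefficient `[a choose b]_q`, as a real number:
`∏_{t < b} (q^{a-t} - 1) / (q^{t+1} - 1)`. It vanishes for `b > a` (the factor `t = a`). -/
noncomputable def gaussBinom (q a b : ℕ) : ℝ :=
  ∏ t ∈ Finset.range b, ((q : ℝ) ^ (a - t) - 1) / ((q : ℝ) ^ (t + 1) - 1)

/-- The `k`-spaces of `PG(n,q)` (projective dimension `k`): the linear subspaces of `F^{n+1}` of
vector space dimension `k + 1`, where `F` is the field with `q` elements.
The points are the `0`-spaces. -/
abbrev KSpace (F : Type*) [Field F] (n k : ℕ) : Type _ :=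
  {U : Submodule F (Fin (n + 1) → F) // Module.finrank F U = k + 1}

noncomputable instance instFintypeKSpace (F : Type*) [Field F] [Finite F] (n k : ℕ) :
    Fintype (KSpace F n k) :=
  Fintype.ofFinite _

noncomputable instance instDecidableEqKSpace (F : Type*) [Field F] (n k : ℕ) :
    DecidableEq (KSpace F n k) :=
  Classical.decEq _

open scoped Classical in
/-- The incidence matrix `A` of points (rows) and `k`-spaces (columns) of `PG(n,q)`. -/
noncomputable def incMatrix (F : Type*) [Field F] (n k : ℕ) :
    Matrix (KSpace F n 0) (KSpace F n k) ℝ :=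
  Matrix.of fun P π => if P.1 ≤ π.1 then 1 else 0

/-- Two `k`-spaces meet in a `(k-i)`-space (a `(-1)`-space being empty):
the intersection has vector space dimension `k - i + 1`. -/
def MeetsInCodim {F : Type*} [Field F] {n k : ℕ} (i : ℕ) (π π' : KSpace F n k) : Prop :=
  Module.finrank F ↥(π.1 ⊓ π'.1) + i = k + 1

open scoped Classical in
/-- The matrix `A_i` of the relation `dim (π ∩ π') = k - i` on `k`-spaces. -/
noncomputable def grassmannMatrix (F : Type*) [Field F] (n k i : ℕ) :
    Matrix (KSpace F n k) (KSpace F n k) ℝ :=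
  Matrix.of fun π π' => if MeetsInCodim i π π' then 1 else 0

/-- The eigenvalue `P_{ji}` of `A_i` on the `j`-th common eigenspace of the Grassmann scheme
`J_q(n+1,k+1)` (used for `n ≥ 2k+1` and `i, j ≤ k+1`, where no subtraction truncates). -/
noncomputable def grassmannEigenvalue (q n k j i : ℕ) : ℝ :=
  ∑ s ∈ Finset.Icc (j - i) (min j (k + 1 - i)),
    (-1 : ℝ) ^ (j + s) * gaussBinom q j s * gaussBinom q (n - k + s - j) (n - k - i) *
      gaussBinom q (k + 1 - s) i * (q : ℝ) ^ (i * (i + s - j) + (j - s) * (j - s - 1) / 2)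

/-- The common eigenspace `V_j` of `A_0, …, A_{k+1}` in `ℝ^{Π_k}`, in the usual ordering:
the vectors `v` with `A_i v = P_{ji} v` for `0 ≤ i ≤ k + 1`. -/
noncomputable def grassmannEigenspace (F : Type*) [Field F] [Finite F] (n k j : ℕ) :
    Submodule ℝ (EuclideanSpace ℝ (KSpace F n k)) :=
  ⨅ i ∈ Finset.range (k + 2),
    Module.End.eigenspace (Matrix.toEuclideanLin (grassmannMatrix F n k i))
      (grassmannEigenvalue (Nat.card F) n k j i)

/-- The characteristic vector of a set of `k`-spaces. -/
noncomputable def charVec {F : Type*} [Field F] {n k : ℕ} (L : Set (KSpace F n k)) :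
    EuclideanSpace ℝ (KSpace F n k) :=
  WithLp.toLp 2 (L.indicator fun _ => (1 : ℝ))

/-- The all-one vector `j`. -/
noncomputable def allOne (F : Type*) [Field F] (n k : ℕ) : EuclideanSpace ℝ (KSpace F n k) :=
  WithLp.toLp 2 fun _ => (1 : ℝ)

/-- A partial `k`-spread: a set of mutually disjoint `k`-spaces. -/
def IsPartialSpread {F : Type*} [Field F] {n k : ℕ} (S : Set (KSpace F n k)) : Prop :=
  S.Pairwise fun π π' => Disjoint π.1 π'.1

/-- The set of points covered by a set of `k`-spaces. -/
def coveredPoints {F : Type*} [Field F] {n k : ℕ} (S : Set (KSpace F n k)) :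
    Set (KSpace F n 0) :=
  {P | ∃ π ∈ S, P.1 ≤ π.1}

/-- A `k`-spread: a partial `k`-spread whose members partition the set of all points. -/
def IsSpread {F : Type*} [Field F] {n k : ℕ} (S : Set (KSpace F n k)) : Prop :=
  IsPartialSpread S ∧ coveredPoints S = Set.univ

/-- A pair of conjugate switching sets: partial `k`-spreads without common members that cover
the same points. -/
def IsConjugateSwitchingPair {F : Type*} [Field F] {n k : ℕ} (R R' : Set (KSpace F n k)) : Prop :=
  IsPartialSpread R ∧ IsPartialSpread R' ∧ R ∩ R' = ∅ ∧ coveredPoints R = coveredPoints R'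

/-- The number of members of `L` meeting a member `π` of `L` in a `(k-i)`-space. For `i = k + 1`
the quotient `[k choose i] / (q^{k-i+1} - 1)` in the general formula has the form `0 / 0` and
stands for `[k+1 choose i] / (q^{k+1} - 1)`, to which it is equal for `i ≤ k`. -/
noncomputable def memberCount (q n k i : ℕ) (x : ℝ) : ℝ :=
  if i ≤ k then
    ((x - 1) * (((q : ℝ) ^ (k + 1) - 1) / ((q : ℝ) ^ (k - i + 1) - 1)) +
        (q : ℝ) ^ i * (((q : ℝ) ^ (n - k) - 1) / ((q : ℝ) ^ i - 1))) *
      (q : ℝ) ^ (i * (i - 1)) * gaussBinom q (n - k - 1) (i - 1) * gaussBinom q k i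
  else (x - 1) * (q : ℝ) ^ (i * (i - 1)) * gaussBinom q (n - k - 1) (i - 1)

/-- The number of members of `L` meeting a non-member `π` of `L` in a `(k-i)`-space. -/
noncomputable def nonMemberCount (q n k i : ℕ) (x : ℝ) : ℝ :=
  x * gaussBinom q (n - k - 1) (i - 1) * gaussBinom q (k + 1) i * (q : ℝ) ^ (i * (i - 1))

/-! Put `K = k + 1`, `N = n + 1`. Everything is compared with property 1, which says that `χ` is a
point sum: `χ(π) = ∑_{P ≤ π} g(P)` for some function `g` on the points. Property 2 is the same by
linear algebra.

For a `K`-subspace `π` and a point `P`, the number of `K`-subspaces through `P` in relation `i` to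
`π` depends only on whether `P ≤ π`. Hence a point sum `f` with `∑ g = x` satisfies `A_i f = θ_{i,1}
f + m_i x` for every `i` (`adjSum_downSum`), which yields 3, 4 and 6.

Conversely, this equation for a single `i ≥ 1` suffices (`isPointSum_of_adjSum_affine`). Subtracting
the point sum of a mass `x` at one point turns it into an eigenvector equation. Project the
eigenvector orthogonally onto the point sums; the remainder `b` is again an eigenvector, and its
sums over the `K`-subspaces through any point vanish. If the sums of `b` through all proper
subspaces of `R` vanish, Möbius inversion shows that `A_i` multiplies the sum through `R` by a
number `θ_{i,r}` depending only on `r = dim R` (`upSum_adjSum_of_vanishing`). So, by induction on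
`r`, all these sums vanish and `b = 0`, provided that `θ_{i,r} ≠ θ_{i,1}` for `r ≥ 2`
(`grassEigen_ne_grassEigen_one`). For `i ≥ 2` the two numbers have different `q`-adic valuations;
for `i = 1` the sequence is strictly decreasing. The spectral decomposition of the Grassmann scheme
is never needed.

For 8, averaging over the images of one spread under `GL(V)`, which is transitive on ordered pairs
of disjoint `K`-subspaces, turns constant spread sums into the equation for `i = K`
(`isPointSum_of_spread`).

For 7, every `2K`-dimensional subspace has a spread, and two spreads of it without their common
members are conjugate switching sets. So `χ` is a point sum inside each such subspace, and the local
point functions glue because they are determined already on `(K+1)`-dimensional subspaces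
(`IsSwitchingInvariant.isPointSum`). -/

/-! ### Gaussian binomial coefficients. -/

/-- The Gaussian binomial coefficient as a natural number, by its Pascal recursion. -/
def qbinom (q : ℕ) : ℕ → ℕ → ℕ
  | _, 0 => 1
  | 0, _ + 1 => 0
  | a + 1, b + 1 => qbinom q a b + q ^ (b + 1) * qbinom q a (b + 1)

@[simp] theorem qbinom_zero_right (q a : ℕ) : qbinom q a 0 = 1 := by
  cases a <;> rfl

@[simp] theorem qbinom_zero_succ (q b : ℕ) : qbinom q 0 (b + 1) = 0 := rfl

theorem qbinom_succ_succ (q a b : ℕ) :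
    qbinom q (a + 1) (b + 1) = qbinom q a b + q ^ (b + 1) * qbinom q a (b + 1) := rfl

theorem qbinom_eq_zero_of_lt (q : ℕ) {a b : ℕ} (h : a < b) : qbinom q a b = 0 := by
  induction a generalizing b with
  | zero => cases b with
    | zero => omega
    | succ b => rfl
  | succ a ih => cases b with
    | zero => omega
    | succ b => rw [qbinom_succ_succ, ih (by omega), ih (by omega)]; simp

@[simp] theorem qbinom_self (q a : ℕ) : qbinom q a a = 1 := by
  induction a with
  | zero => rfl
  | succ a ih => rw [qbinom_succ_succ, ih, qbinom_eq_zero_of_lt q (Nat.lt_succ_self a)]; simp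

/-- A non-trivial Gaussian binomial coefficient is `1` modulo `q`. -/
theorem exists_qbinom_eq (q : ℕ) {a b : ℕ} (h : b ≤ a) : ∃ c, qbinom q a b = 1 + q * c := by
  induction a generalizing b with
  | zero => obtain rfl : b = 0 := by omega
            exact ⟨0, rfl⟩
  | succ a ih => cases b with
    | zero => exact ⟨0, by simp⟩
    | succ b =>
      obtain ⟨c, hc⟩ := ih (b := b) (by omega)
      exact ⟨c + q ^ b * qbinom q a (b + 1), by rw [qbinom_succ_succ, hc]; ring⟩

theorem qbinom_pos (q : ℕ) {a b : ℕ} (h : b ≤ a) : 0 < qbinom q a b := by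
  obtain ⟨c, hc⟩ := exists_qbinom_eq q h
  omega

theorem qbinom_mul_prod (q a b : ℕ) :
    (qbinom q a b : ℝ) * ∏ t ∈ Finset.range b, ((q : ℝ) ^ (t + 1) - 1) =
      ∏ t ∈ Finset.range b, ((q : ℝ) ^ (a - t) - 1) := by
  induction a generalizing b with
  | zero => cases b with
    | zero => simp
    | succ b => simp
  | succ a ih => cases b with
    | zero => simp
    | succ b =>
      rw [qbinom_succ_succ, Finset.prod_range_succ' (fun t => (q : ℝ) ^ (a + 1 - t) - 1)]
      have h1 := ih b
      have h2 := ih (b + 1)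
      rw [Finset.prod_range_succ (fun t => (q : ℝ) ^ (a - t) - 1)] at h2
      simp only [Nat.add_sub_add_right, Nat.sub_zero]
      push_cast
      rw [add_mul, mul_assoc, h2, Finset.prod_range_succ, ← mul_assoc, h1]
      rcases le_or_gt b a with h | h
      · have : (q : ℝ) ^ (a + 1) = q ^ (b + 1) * q ^ (a - b) := by
          rw [← pow_add]; congr 1; omega
        rw [this]; ring
      -- For `b > a` the truncated factor at `t = a` is `q^0 - 1 = 0`.
      · rw [Finset.prod_eq_zero (Finset.mem_range.mpr h) (by simp)]; ring

theorem q_pow_sub_one_pos {q : ℕ} (hq : 2 ≤ q) {t : ℕ} (ht : t ≠ 0) :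
    (0 : ℝ) < (q : ℝ) ^ t - 1 := by
  have : (1 : ℝ) < q := by exact_mod_cast hq
  linarith [one_lt_pow₀ this ht]

theorem prod_q_pow_sub_one_pos {q : ℕ} (hq : 2 ≤ q) (b : ℕ) :
    0 < ∏ t ∈ Finset.range b, ((q : ℝ) ^ (t + 1) - 1) :=
  Finset.prod_pos fun _ _ => q_pow_sub_one_pos hq (Nat.succ_ne_zero _)

theorem gaussBinom_eq_qbinom {q : ℕ} (hq : 2 ≤ q) (a b : ℕ) : gaussBinom q a b = qbinom q a b := by
  rw [gaussBinom, Finset.prod_div_distrib, ← qbinom_mul_prod,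
    mul_div_cancel_right₀ _ (prod_q_pow_sub_one_pos hq b).ne']

theorem qbinom_one_right (q a : ℕ) :
    (qbinom q a 1 : ℝ) * ((q : ℝ) - 1) = (q : ℝ) ^ a - 1 := by
  simpa using qbinom_mul_prod q a 1

/-- The number of ordered bases of a `b`-space, times the number of `b`-spaces, is the number of
independent `b`-tuples. -/
theorem qbinom_mul_prod_sub (q a b : ℕ) :
    (qbinom q a b : ℝ) * ∏ t ∈ Finset.range b, ((q : ℝ) ^ b - (q : ℝ) ^ t) =
      ∏ t ∈ Finset.range b, ((q : ℝ) ^ a - (q : ℝ) ^ t) := by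
  rcases lt_or_ge a b with h | h
  · rw [qbinom_eq_zero_of_lt q h, Nat.cast_zero, zero_mul,
      Finset.prod_eq_zero (i := a) (Finset.mem_range.mpr h) (sub_self _)]
  · have key : ∀ c, b ≤ c → ∏ t ∈ Finset.range b, ((q : ℝ) ^ c - (q : ℝ) ^ t) =
        (∏ t ∈ Finset.range b, (q : ℝ) ^ t) * ∏ t ∈ Finset.range b, ((q : ℝ) ^ (c - t) - 1) := by
      intro c hc
      rw [← Finset.prod_mul_distrib]
      refine Finset.prod_congr rfl fun t ht => ?_
      rw [mul_sub, ← pow_add, mul_one, Nat.add_sub_cancel' (by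
        have := Finset.mem_range.mp ht; omega)]
    rw [key a h, key b le_rfl, ← qbinom_mul_prod q a b, ← qbinom_mul_prod q b b, qbinom_self]
    push_cast; ring

theorem prod_q_pow_sub_pos {q : ℕ} (hq : 2 ≤ q) (b : ℕ) :
    0 < ∏ t ∈ Finset.range b, ((q : ℝ) ^ b - (q : ℝ) ^ t) := by
  refine Finset.prod_pos fun t ht => ?_
  have : (1 : ℝ) < q := by exact_mod_cast hq
  linarith [pow_lt_pow_right₀ this (Finset.mem_range.mp ht)]

theorem qbinom_symm {q : ℕ} (hq : 2 ≤ q) {a b : ℕ} (h : b ≤ a) :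
    qbinom q a (a - b) = qbinom q a b := by
  have key : ∀ c ≤ a, (qbinom q a c : ℝ) * ((∏ t ∈ Finset.range c, ((q : ℝ) ^ (t + 1) - 1)) *
      ∏ t ∈ Finset.range (a - c), ((q : ℝ) ^ (t + 1) - 1)) =
      ∏ t ∈ Finset.range a, ((q : ℝ) ^ (t + 1) - 1) := by
    intro c hc
    rw [← mul_assoc, qbinom_mul_prod, ← Finset.prod_range_reflect _ a]
    conv_rhs => rw [← Nat.add_sub_cancel' hc, Finset.prod_range_add]
    rw [← Finset.prod_range_reflect _ (a - c)]
    congr 1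
    · refine Finset.prod_congr rfl fun t ht => ?_
      have := Finset.mem_range.mp ht
      congr 2; omega
    · refine Finset.prod_congr rfl fun t ht => ?_
      have := Finset.mem_range.mp ht
      congr 2; omega
  have h1 := key b h
  have h2 := key (a - b) (Nat.sub_le _ _)
  rw [Nat.sub_sub_self h, mul_comm (∏ t ∈ Finset.range (a - b), _)] at h2
  have h3 := mul_right_cancel₀ (mul_pos (prod_q_pow_sub_one_pos hq b)
    (prod_q_pow_sub_one_pos hq (a - b))).ne' (h2.trans h1.symm)
  exact_mod_cast h3

/-- Pascal recursion at the top: `[a+1, b+1] (q^{b+1} - 1) = (q^{a+1} - 1) [a, b]`. -/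
theorem qbinom_succ_succ_mul {q : ℕ} (hq : 2 ≤ q) (a b : ℕ) :
    (qbinom q (a + 1) (b + 1) : ℝ) * ((q : ℝ) ^ (b + 1) - 1) =
      ((q : ℝ) ^ (a + 1) - 1) * qbinom q a b := by
  have h := qbinom_mul_prod q (a + 1) (b + 1)
  rw [Finset.prod_range_succ, Finset.prod_range_succ' (fun t => (q : ℝ) ^ (a + 1 - t) - 1)] at h
  simp only [Nat.add_sub_add_right, Nat.sub_zero] at h
  rw [← qbinom_mul_prod q a b] at h
  refine mul_right_cancel₀ (prod_q_pow_sub_one_pos hq b).ne' ?_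
  linear_combination h

/-- `[a+1, b] (q^{a+1-b} - 1) = (q^{a+1} - 1) [a, b]` for `b ≤ a`. -/
theorem qbinom_succ_left_mul {q : ℕ} (hq : 2 ≤ q) {a b : ℕ} (h : b ≤ a) :
    (qbinom q (a + 1) b : ℝ) * ((q : ℝ) ^ (a + 1 - b) - 1) =
      ((q : ℝ) ^ (a + 1) - 1) * qbinom q a b := by
  have := qbinom_succ_succ_mul hq a (a - b)
  rw [qbinom_symm hq h] at this
  rw [← this, ← qbinom_symm hq (show b ≤ a + 1 by omega)]
  have e : a + 1 - b = a - b + 1 := by omega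
  rw [e]

/-- The Gauss summation formula at `1`. -/
theorem sum_alternating_qbinom (q d : ℕ) (hd : d ≠ 0) :
    ∑ e ∈ Finset.range (d + 1), (-1 : ℤ) ^ e * (q : ℤ) ^ (e.choose 2) * qbinom q d e = 0 := by
  obtain ⟨a, rfl⟩ := Nat.exists_eq_succ_of_ne_zero hd
  have hw : ∀ e, (e + 1).choose 2 = e + e.choose 2 := fun e => by
    rw [Nat.choose_succ_succ' e 1, Nat.choose_one_right]
  -- The Pascal recursion makes the sum telescope: the summand of index `e + 1` is `t e - t (e + 1)`
  -- with `t e = (-1)^(e+1) q^(e+1 choose 2) [a, e]`.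
  have key : ∀ e ∈ Finset.range (a + 1),
      (-1 : ℤ) ^ (e + 1) * (q : ℤ) ^ ((e + 1).choose 2) * qbinom q (a + 1) (e + 1) =
      (-1 : ℤ) ^ (e + 1) * (q : ℤ) ^ ((e + 1).choose 2) * qbinom q a e -
      (-1 : ℤ) ^ (e + 1 + 1) * (q : ℤ) ^ ((e + 1 + 1).choose 2) * qbinom q a (e + 1) := by
    intro e _
    rw [qbinom_succ_succ, hw (e + 1), pow_add _ (e + 1) ((e + 1).choose 2)]
    push_cast; ring
  rw [Finset.sum_range_succ', Finset.sum_congr rfl key,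
    Finset.sum_range_sub' (fun e => (-1 : ℤ) ^ (e + 1) * (q : ℤ) ^ ((e + 1).choose 2) *
      qbinom q a e), qbinom_eq_zero_of_lt q (Nat.lt_succ_self a)]
  simp

open Module

/-! ### Counting subspaces with a prescribed intersection. -/

section Counting

variable {F V : Type*} [Field F] [AddCommGroup V] [Module F V]

/-- `m`-tuples that are linearly independent modulo the subspace `C`. -/
def IndepMod (C : Submodule F V) {m : ℕ} (v : Fin m → V) : Prop :=
  ∀ g : Fin m → F, ∑ i, g i • v i ∈ C → ∀ i, g i = 0

theorem indepMod_iff (C : Submodule F V) {m : ℕ} (v : Fin m → V) :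
    IndepMod C v ↔ LinearIndependent F (fun i => C.mkQ (v i)) := by
  rw [Fintype.linearIndependent_iff]
  refine forall_congr' fun g => ?_
  rw [← Submodule.Quotient.mk_eq_zero, ← Submodule.mkQ_apply, map_sum]
  simp only [map_smul]

/-- The linear complement data of `C`: a tuple modulo `C` and a correction in `C`. -/
noncomputable def indepModEquiv (C : Submodule F V) (m : ℕ) :
    {v : Fin m → V // IndepMod C v} ≃
      {w : Fin m → V ⧸ C // LinearIndependent F w} × (Fin m → C) where
  toFun v := (⟨fun i => C.mkQ (v.1 i), (indepMod_iff C v.1).1 v.2⟩,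
    fun i => ⟨v.1 i - Function.surjInv C.mkQ_surjective (C.mkQ (v.1 i)), by
      rw [← Submodule.Quotient.mk_eq_zero, ← Submodule.mkQ_apply, map_sub,
        Function.surjInv_eq C.mkQ_surjective, sub_self]⟩)
  invFun w := ⟨fun i => Function.surjInv C.mkQ_surjective (w.1.1 i) + w.2 i, by
    rw [indepMod_iff]
    convert w.1.2 using 2 with i
    rw [map_add, Function.surjInv_eq C.mkQ_surjective, Submodule.mkQ_apply,
      (Submodule.Quotient.mk_eq_zero C).2 (w.2 i).2, add_zero]⟩
  left_inv v := by
    ext i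
    simp
  right_inv w := by
    have h : ∀ i, C.mkQ (Function.surjInv C.mkQ_surjective (w.1.1 i) + (w.2 i : V)) = w.1.1 i := by
      intro i
      rw [map_add, Function.surjInv_eq C.mkQ_surjective, Submodule.mkQ_apply,
        (Submodule.Quotient.mk_eq_zero C).2 (w.2 i).2, add_zero]
    refine Prod.ext (Subtype.ext (funext fun i => h i)) (funext fun i => Subtype.ext ?_)
    simp only [h]
    abel

/-- A tuple independent modulo `C` is an independent tuple of `V ⧸ C` together with one of the
`|C|^m` lifts. For `m > d` both sides vanish. -/
theorem card_indepMod [Finite F] [Finite V] (C : Submodule F V) {c d m : ℕ}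
    (hc : finrank F C = c) (hd : c + d = finrank F V) :
    (Nat.card {v : Fin m → V // IndepMod C v} : ℝ) =
      (Nat.card F : ℝ) ^ (c * m) *
        ∏ t ∈ Finset.range m, ((Nat.card F : ℝ) ^ d - (Nat.card F : ℝ) ^ t) := by
  classical
  have := Fintype.ofFinite F
  have hQ : finrank F (V ⧸ C) = d := by
    have := C.finrank_quotient_add_finrank; omega
  have : Finite (V ⧸ C) := Finite.of_surjective _ C.mkQ_surjective
  have hq : 1 < Nat.card F := Finite.one_lt_card
  rw [Nat.card_congr (indepModEquiv C m), Nat.card_prod, Nat.card_fun,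
    Nat.card_eq_fintype_card (α := Fin m),
    Fintype.card_fin, Module.natCard_eq_pow_finrank (K := F) (V := C), hc, ← pow_mul]
  rcases le_or_gt m d with h | h
  · rw [card_linearIndependent (by rw [hQ]; exact h), hQ, ← Nat.card_eq_fintype_card,
      Fin.prod_univ_eq_prod_range (fun t => Nat.card F ^ d - Nat.card F ^ t), mul_comm]
    push_cast
    congr 1
    refine Finset.prod_congr rfl fun t ht => ?_
    rw [Nat.cast_sub (Nat.pow_le_pow_right hq.le (by have := Finset.mem_range.mp ht; omega))]
    push_cast; rfl
  · rw [Finset.prod_eq_zero (i := d) (Finset.mem_range.mpr h) (sub_self _)]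
    have : IsEmpty {w : Fin m → V ⧸ C // LinearIndependent F w} := by
      refine ⟨fun w => ?_⟩
      have := w.2.fintype_card_le_finrank
      rw [Fintype.card_fin, hQ] at this
      omega
    rw [Nat.card_of_isEmpty]; simp

theorem IndepMod.linearIndependent {C : Submodule F V} {m : ℕ} {v : Fin m → V}
    (h : IndepMod C v) : LinearIndependent F v :=
  Fintype.linearIndependent_iff.2 fun g hg => h g (hg ▸ C.zero_mem)

theorem IndepMod.mono {B C : Submodule F V} (hBC : B ≤ C) {m : ℕ} {v : Fin m → V}
    (h : IndepMod C v) : IndepMod B v := fun g hg => h g (hBC hg)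

theorem IndepMod.sup_span_inf {B C : Submodule F V} (hBC : B ≤ C) {m : ℕ} {v : Fin m → V}
    (h : IndepMod C v) : (B ⊔ Submodule.span F (Set.range v)) ⊓ C = B := by
  refine le_antisymm ?_ (le_inf le_sup_left hBC)
  rintro x ⟨hx, hxC⟩
  obtain ⟨b, hb, y, hy, rfl⟩ := Submodule.mem_sup.1 hx
  obtain ⟨g, rfl⟩ := (Submodule.mem_span_range_iff_exists_fun F).1 hy
  have hg := h g ((Submodule.add_mem_iff_right C (hBC hb)).1 hxC)
  simpa [hg] using hb

theorem IndepMod.finrank_sup_span [Finite V] {B : Submodule F V} {m : ℕ} {v : Fin m → V}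
    (h : IndepMod B v) : finrank F ↥(B ⊔ Submodule.span F (Set.range v)) = finrank F B + m := by
  have h1 := Submodule.finrank_sup_add_finrank_inf_eq B (Submodule.span F (Set.range v))
  have h2 : B ⊓ Submodule.span F (Set.range v) = ⊥ := by
    refine (Submodule.eq_bot_iff _).2 ?_
    rintro x ⟨hx, hy⟩
    obtain ⟨g, rfl⟩ := (Submodule.mem_span_range_iff_exists_fun F).1 hy
    simp [h g hx]
  rw [h2, finrank_bot, finrank_span_eq_card h.linearIndependent, Fintype.card_fin] at h1
  omega

theorem two_le_natCard (F : Type*) [Field F] [Finite F] : 2 ≤ Nat.card F := Finite.one_lt_card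

/-- The number of subspaces of dimension `b + m` that meet `C` exactly in the given `b`-dimensional
subspace `B` of `C`. -/
theorem card_inf_eq [Finite F] [Finite V] {B C : Submodule F V} (hBC : B ≤ C) {b i e m : ℕ}
    (hb : finrank F B = b) (hc : finrank F C = b + i) (he : b + i + e = finrank F V) :
    Nat.card {π : Submodule F V // π ⊓ C = B ∧ finrank F π = b + m} =
      Nat.card F ^ (i * m) * qbinom (Nat.card F) e m := by
  classical
  have hq : 2 ≤ Nat.card F := two_le_natCard F
  have hext : ∀ x y : Σ π : {π : Submodule F V // π ⊓ C = B ∧ finrank F π = b + m},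
        {w : Fin m → π.1 // IndepMod (B.comap π.1.subtype) w},
      x.1.1 = y.1.1 → (∀ j, (x.2.1 j : V) = y.2.1 j) → x = y := by
    rintro ⟨⟨π, _, _⟩, w, _⟩ ⟨⟨π', _, _⟩, w', _⟩ h h'
    dsimp only at h
    subst h
    obtain rfl : w = w' := funext fun j => Subtype.ext (h' j)
    rfl
  have := Fintype.ofFinite {π : Submodule F V // π ⊓ C = B ∧ finrank F π = b + m}
  -- Double counting: such a tuple determines `π = B + ⟨v⟩` and is a basis of `π` modulo `B`.
  -- Conversely, a basis of `π` modulo `B` is independent modulo `C`, since `π ⊓ C = B`.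
  have E : {v : Fin m → V // IndepMod C v} ≃
      Σ π : {π : Submodule F V // π ⊓ C = B ∧ finrank F π = b + m},
        {w : Fin m → π.1 // IndepMod (B.comap π.1.subtype) w} :=
    { toFun := fun v => ⟨⟨B ⊔ Submodule.span F (Set.range v.1), v.2.sup_span_inf hBC, by
          rw [(v.2.mono hBC).finrank_sup_span, hb]⟩,
        fun j => ⟨v.1 j, Submodule.mem_sup_right (Submodule.subset_span ⟨j, rfl⟩)⟩, by
          intro g hg
          apply v.2.mono hBC g
          simpa using hg⟩
      invFun := fun w => ⟨fun j => (w.2.1 j : V), by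
          intro g hg
          apply w.2.2 g
          rw [Submodule.mem_comap]
          have : (∑ i, g i • (w.2.1 i : V)) = w.1.1.subtype (∑ i, g i • w.2.1 i) := by simp
          rw [← this]
          nth_rw 1 [← w.1.2.1]
          exact ⟨by rw [this]; exact (∑ i, g i • w.2.1 i).2, hg⟩⟩
      left_inv := fun v => rfl
      right_inv := by
        rintro ⟨⟨π, hπ, hd⟩, w, hw⟩
        have hw' : IndepMod B (fun j => (w j : V)) := by
          intro g hg
          apply hw g
          simpa using hg
        have hle : B ⊔ Submodule.span F (Set.range fun j => (w j : V)) ≤ π := by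
          refine sup_le (hπ ▸ inf_le_left) (Submodule.span_le.2 ?_)
          rintro _ ⟨j, rfl⟩
          exact (w j).2
        exact hext _ _ (Submodule.eq_of_le_of_finrank_eq hle (by
          rw [hw'.finrank_sup_span, hb, hd])) fun j => rfl }
  have hcard := card_indepMod (m := m) C hc he
  rw [Nat.card_congr E, Nat.card_sigma] at hcard
  have hfib : ∀ π : {π : Submodule F V // π ⊓ C = B ∧ finrank F π = b + m},
      (Nat.card {w : Fin m → π.1 // IndepMod (B.comap π.1.subtype) w} : ℝ) =
      (Nat.card F : ℝ) ^ (b * m) *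
        ∏ t ∈ Finset.range m, ((Nat.card F : ℝ) ^ m - (Nat.card F : ℝ) ^ t) := by
    rintro ⟨π, hπ, hd⟩
    have hBπ : B ≤ π := hπ ▸ inf_le_left
    exact card_indepMod _ (by rw [(Submodule.comapSubtypeEquivOfLe hBπ).finrank_eq, hb]) hd.symm
  push_cast at hcard
  rw [Finset.sum_congr rfl fun π _ => hfib π, Finset.sum_const, nsmul_eq_mul, Finset.card_univ,
    ← Nat.card_eq_fintype_card, ← qbinom_mul_prod_sub (Nat.card F) e m, add_mul, pow_add] at hcard
  have h0 : (0 : ℝ) < (Nat.card F : ℝ) ^ (b * m) := by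
    have : (0 : ℝ) < Nat.card F := by exact_mod_cast (by omega : 0 < Nat.card F)
    positivity
  have h1 := prod_q_pow_sub_pos hq m
  have h2 : (Nat.card {π : Submodule F V // π ⊓ C = B ∧ finrank F π = b + m} : ℝ) =
      (Nat.card F : ℝ) ^ (i * m) * qbinom (Nat.card F) e m :=
    mul_right_cancel₀ (mul_pos h0 h1).ne' (by rw [hcard]; ring)
  exact_mod_cast h2

end Counting

/-! ### Counting `K`-subspaces through `R` in a given relation to `π'`. -/

section GrassCounting

/-- The finite set of subspaces of vector space dimension `K`. -/
noncomputable def grass (F V : Type*) [Field F] [AddCommGroup V] [Module F V] [Finite V]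
    (K : ℕ) : Finset (Submodule F V) :=
  (Set.toFinite {π : Submodule F V | finrank F π = K}).toFinset

@[simp] theorem mem_grass {F V : Type*} [Field F] [AddCommGroup V] [Module F V] [Finite V]
    {K : ℕ} {π : Submodule F V} : π ∈ grass F V K ↔ finrank F π = K := by
  simp [grass]

/-- Modular law. It rewrites "contains `R` and meets `π'` in `D`" as a prescribed intersection with
the single subspace `π' ⊔ R`, the form that `card_grass_inf_eq` counts. -/
theorem inf_sup_eq_iff {F V : Type*} [Field F] [AddCommGroup V] [Module F V]
    {R π π' D : Submodule F V} (hR : R ≤ π) (h1 : R ⊓ π' ≤ D) (h2 : D ≤ π') :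
    π ⊓ (π' ⊔ R) = D ⊔ R ↔ π ⊓ π' = D := by
  constructor
  · intro h
    calc π ⊓ π' = π ⊓ (π' ⊔ R) ⊓ π' := by
          rw [inf_assoc, inf_eq_right.2 (le_sup_left : π' ≤ π' ⊔ R)]
      _ = (D ⊔ R) ⊓ π' := by rw [h]
      _ = D := by rw [sup_inf_assoc_of_le _ h2, sup_eq_left.2 h1]
  · intro h
    rw [sup_comm π' R, inf_comm, sup_inf_assoc_of_le _ hR, inf_comm, h, sup_comm]

variable {F V : Type*} [Field F] [Finite F] [AddCommGroup V] [Module F V] [Finite V]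

open scoped Classical in
theorem card_grass_inf_eq {B C : Submodule F V} (hBC : B ≤ C) {b i e m : ℕ}
    (hb : finrank F B = b) (hc : finrank F C = b + i) (he : b + i + e = finrank F V) :
    ((grass F V (b + m)).filter fun π => π ⊓ C = B).card =
      Nat.card F ^ (i * m) * qbinom (Nat.card F) e m := by
  rw [← card_inf_eq hBC hb hc he, Nat.subtype_card]
  intro π
  simp [and_comm]

open scoped Classical in
theorem card_grass_ge (B : Submodule F V) {K : ℕ} (hK : finrank F B ≤ K) :
    ((grass F V K).filter fun π => B ≤ π).card =
      qbinom (Nat.card F) (finrank F V - finrank F B) (K - finrank F B) := by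
  have h := card_grass_inf_eq (B := B) (C := B) le_rfl (b := finrank F B) (i := 0)
    (e := finrank F V - finrank F B) (m := K - finrank F B) rfl rfl
    (by have := Submodule.finrank_le B; omega)
  rw [Nat.add_sub_cancel' hK] at h
  simpa using h

open scoped Classical in
theorem card_grass_Icc {T R : Submodule F V} (hTR : T ≤ R) {s : ℕ} (hs : finrank F T ≤ s) :
    ((grass F V s).filter fun S => T ≤ S ∧ S ≤ R).card =
      qbinom (Nat.card F) (finrank F R - finrank F T) (s - finrank F T) := by
  have hT : finrank F (T.comap R.subtype) = finrank F T :=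
    (Submodule.comapSubtypeEquivOfLe hTR).finrank_eq
  rw [← hT, ← card_grass_ge (V := R) (T.comap R.subtype) (hT.symm ▸ hs)]
  refine Finset.card_nbij' (fun S => S.comap R.subtype) (fun S => S.map R.subtype) ?_ ?_ ?_ ?_
  · intro S hS
    simp only [Finset.coe_filter, mem_grass, Set.mem_ofPred_eq] at hS ⊢
    exact ⟨by rw [(Submodule.comapSubtypeEquivOfLe hS.2.2).finrank_eq, hS.1],
      Submodule.comap_mono hS.2.1⟩
  · intro S hS
    simp only [Finset.coe_filter, mem_grass, Set.mem_ofPred_eq] at hS ⊢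
    refine ⟨by rw [Submodule.finrank_map_subtype_eq]; exact hS.1, ?_, R.map_subtype_le S⟩
    rw [← Submodule.map_comap_eq_of_le (f := R.subtype) (p := T) (by simpa using hTR)]
    exact Submodule.map_mono hS.2
  · intro S hS
    simp only [Finset.coe_filter, mem_grass, Set.mem_ofPred_eq] at hS
    exact Submodule.map_comap_eq_of_le (by simpa using hS.2.2)
  · intro S hS
    exact Submodule.comap_map_eq_of_injective R.injective_subtype S

/-- Number of `K`-subspaces containing `R` and meeting `π'` in codimension `i`, where `R` has
codimension `d` over its `t`-dimensional intersection with `π'`. -/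
def meetCount (q N K i t d : ℕ) : ℕ :=
  if d ≤ i then qbinom q (K - t) i * (q ^ (i * (i - d)) * qbinom q (N - K - d) (i - d)) else 0

-- Fibre over `D = π ⊓ π'`, which runs through the `(K-i)`-dimensional subspaces between `R ⊓ π'`
-- and `π'`. Each fibre consists of the `π` meeting `π' ⊔ R` exactly in `D ⊔ R`. As `D ⊔ R` has
-- dimension `K - i + d`, the fibre is empty for `d > i`.
open scoped Classical in
theorem card_meets {R π' : Submodule F V} {K i t d : ℕ} (hi : i ≤ K) (hR : finrank F R = t + d)
    (hT : finrank F ↥(R ⊓ π') = t) (hπ' : finrank F π' = K) :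
    ((grass F V K).filter fun π => R ≤ π ∧ finrank F ↥(π ⊓ π') + i = K).card =
      meetCount (Nat.card F) (finrank F V) K i t d := by
  have hq : 2 ≤ Nat.card F := two_le_natCard F
  have htK : t ≤ K := by
    rw [← hT, ← hπ']; exact Submodule.finrank_mono inf_le_right
  set G := (grass F V K).filter fun π => R ≤ π ∧ finrank F ↥(π ⊓ π') + i = K with hG
  set DD := (grass F V (K - i)).filter fun D => R ⊓ π' ≤ D ∧ D ≤ π' with hDD
  have hmaps : ∀ π ∈ G, π ⊓ π' ∈ DD := by
    intro π hπ
    simp only [hG, hDD, Finset.mem_filter, mem_grass] at hπ ⊢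
    exact ⟨by omega, inf_le_inf_right _ hπ.2.1, inf_le_right⟩
  have hfib : ∀ D ∈ DD, ((G.filter fun π => π ⊓ π' = D).card) =
      if d ≤ i then Nat.card F ^ (i * (i - d)) * qbinom (Nat.card F) (finrank F V - K - d) (i - d)
      else 0 := by
    intro D hD
    simp only [hDD, Finset.mem_filter, mem_grass] at hD
    obtain ⟨hD, h1, h2⟩ := hD
    have hDR : finrank F ↥(D ⊔ R) = K - i + d := by
      have := Submodule.finrank_sup_add_finrank_inf_eq D R
      have h3 : D ⊓ R = R ⊓ π' :=
        le_antisymm (le_inf inf_le_right (inf_le_left.trans h2)) (le_inf h1 inf_le_left)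
      rw [h3, hT] at this
      omega
    have hC : finrank F ↥(π' ⊔ R) = K - i + d + i := by
      have := Submodule.finrank_sup_add_finrank_inf_eq π' R
      rw [inf_comm, hT] at this
      omega
    have hCV := Submodule.finrank_le (π' ⊔ R)
    split_ifs with hdi
    · have h := card_grass_inf_eq (sup_le_sup_right h2 R : D ⊔ R ≤ π' ⊔ R) (m := i - d)
        (e := finrank F V - K - d) hDR hC (by omega)
      rw [show K - i + d + (i - d) = K by omega] at h
      rw [← h]
      congr 1
      ext π
      simp only [hG, Finset.mem_filter, mem_grass]
      constructor
      · rintro ⟨⟨h3, h4, h5⟩, h6⟩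
        exact ⟨h3, (inf_sup_eq_iff h4 h1 h2).2 h6⟩
      · rintro ⟨h3, h4⟩
        have h5 : R ≤ π := le_sup_right.trans (h4.ge.trans inf_le_left)
        have h6 := (inf_sup_eq_iff h5 h1 h2).1 h4
        exact ⟨⟨h3, h5, by rw [h6]; omega⟩, h6⟩
    · rw [Finset.card_eq_zero, Finset.filter_eq_empty_iff]
      intro π hπ h6
      simp only [hG, Finset.mem_filter, mem_grass] at hπ
      have := Submodule.finrank_mono
        ((inf_sup_eq_iff hπ.2.1 h1 h2).2 h6 ▸ inf_le_left : D ⊔ R ≤ π)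
      omega
  have hDcard : DD.card = qbinom (Nat.card F) (K - t) i := by
    rcases le_or_gt t (K - i) with h | h
    · have := card_grass_Icc (inf_le_right : R ⊓ π' ≤ π') (s := K - i) (by omega)
      rw [hT, hπ'] at this
      rw [hDD, this, ← qbinom_symm hq (show i ≤ K - t by omega)]
      congr 1; omega
    · rw [qbinom_eq_zero_of_lt _ (by omega), hDD, Finset.card_eq_zero,
        Finset.filter_eq_empty_iff]
      intro D hD h1
      have := Submodule.finrank_mono h1.1
      rw [mem_grass] at hD
      omega
  rw [Finset.card_eq_sum_card_fiberwise hmaps, Finset.sum_congr rfl hfib, Finset.sum_const,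
    hDcard, meetCount]
  split_ifs <;> simp

end GrassCounting

/-! ### Sums through a subspace, and the action of the relations on them. -/

section Operators

/-- The signed Möbius coefficient `(-1)^d q^{d(d-1)/2}` of a subspace interval of length `d`. -/
def qmoebius (q d : ℕ) : ℤ := (-1) ^ d * (q : ℤ) ^ (d.choose 2)

/-- The eigenvalue of the relation `dim (π ∩ π') = K - i` on the `r`-th eigenspace. -/
def grassEigen (q N K i r : ℕ) : ℤ :=
  ∑ d ∈ Finset.range (r + 1), qbinom q r d * (qmoebius q d * meetCount q N K i (r - d) d)

variable {F V : Type*} [Field F] [AddCommGroup V] [Module F V] [Finite V]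

/-- The finite set of subspaces between `T` and `R`. -/
noncomputable def subspaceIcc (T R : Submodule F V) : Finset (Submodule F V) :=
  (Set.toFinite (Set.Icc T R)).toFinset

@[simp] theorem mem_subspaceIcc {T R S : Submodule F V} :
    S ∈ subspaceIcc T R ↔ T ≤ S ∧ S ≤ R := by
  simp [subspaceIcc]

open scoped Classical in
/-- The sum of `f` over the `K`-dimensional subspaces containing `R`. -/
noncomputable def upSum (K : ℕ) (f : Submodule F V → ℝ) (R : Submodule F V) : ℝ :=
  ∑ π ∈ (grass F V K).filter fun π => R ≤ π, f π

open scoped Classical in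
/-- The sum of `f` over the `K`-dimensional subspaces meeting `π` in codimension `i`. -/
noncomputable def adjSum (K i : ℕ) (f : Submodule F V → ℝ) (π : Submodule F V) : ℝ :=
  ∑ π' ∈ (grass F V K).filter fun π' => finrank F ↥(π ⊓ π') + i = K, f π'

open scoped Classical in
/-- The sum of the point function `g` over the points of `π`. -/
noncomputable def downSum (g : Submodule F V → ℝ) (π : Submodule F V) : ℝ :=
  ∑ P ∈ (grass F V 1).filter fun P => P ≤ π, g P

theorem upSum_self {K : ℕ} (f : Submodule F V → ℝ) {π : Submodule F V} (hπ : finrank F π = K) :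
    upSum K f π = f π := by
  classical
  have : (grass F V K).filter (fun π' => π ≤ π') = {π} := by
    ext π'
    simp only [Finset.mem_filter, mem_grass, Finset.mem_singleton]
    constructor
    · rintro ⟨h1, h2⟩
      exact (Submodule.eq_of_le_of_finrank_eq h2 (hπ.trans h1.symm)).symm
    · rintro rfl
      exact ⟨hπ, le_rfl⟩
  rw [upSum, this, Finset.sum_singleton]

theorem upSum_bot (K : ℕ) (f : Submodule F V → ℝ) : upSum K f ⊥ = ∑ π ∈ grass F V K, f π := by
  simp [upSum]

variable [Finite F]

theorem sum_subspaceIcc {T R : Submodule F V} (hTR : T ≤ R) {d : ℕ}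
    (hd : finrank F T + d = finrank F R) (φ : ℕ → ℝ) :
    ∑ S ∈ subspaceIcc T R, φ (finrank F R - finrank F S) =
      ∑ e ∈ Finset.range (d + 1), qbinom (Nat.card F) d e * φ e := by
  classical
  have hmaps : ∀ S ∈ subspaceIcc T R, finrank F R - finrank F S ∈ Finset.range (d + 1) := by
    intro S hS
    have := Submodule.finrank_mono (mem_subspaceIcc.1 hS).1
    rw [Finset.mem_range]; omega
  rw [← Finset.sum_fiberwise_of_maps_to hmaps]
  refine Finset.sum_congr rfl fun e he => ?_
  have he' := Finset.mem_range.1 he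
  rw [Finset.sum_congr rfl (g := fun _ => φ e) fun S hS => by rw [(Finset.mem_filter.1 hS).2],
    Finset.sum_const, nsmul_eq_mul]
  congr 2
  have h := card_grass_Icc hTR (s := finrank F R - e) (by omega)
  rw [show finrank F R - finrank F T = d by omega,
    show finrank F R - e - finrank F T = d - e by omega,
    qbinom_symm (two_le_natCard F) (by omega)] at h
  rw [← h]
  congr 1
  ext S
  simp only [Finset.mem_filter, mem_subspaceIcc, mem_grass]
  constructor
  · rintro ⟨h1, h2⟩
    have := Submodule.finrank_mono h1.2
    exact ⟨by omega, h1⟩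
  · rintro ⟨h1, h2⟩
    exact ⟨h2, by omega⟩

open scoped Classical in
/-- Möbius inversion over the subspaces of `R`. -/
theorem sum_inf_eq {K : ℕ} {f : Submodule F V → ℝ} {R : Submodule F V}
    (hf : ∀ S ≤ R, S ≠ R → upSum K f S = 0) {d : ℕ} {T : Submodule F V} (hT : T ≤ R)
    (hd : finrank F T + d = finrank F R) :
    ∑ π ∈ (grass F V K).filter (fun π => π ⊓ R = T), f π =
      qmoebius (Nat.card F) d * upSum K f R := by
  induction d using Nat.strong_induction_on generalizing T with
  | _ d ih =>
    rcases Nat.eq_zero_or_pos d with rfl | hpos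
    · obtain rfl : T = R := Submodule.eq_of_le_of_finrank_eq hT (by omega)
      simp [qmoebius, upSum]
    · have hne : T ≠ R := by rintro rfl; omega
      have h1 : upSum K f T = ∑ S ∈ subspaceIcc T R,
          ∑ π ∈ (grass F V K).filter (fun π => π ⊓ R = S), f π := by
        have hmaps : ∀ π ∈ (grass F V K).filter (fun π => T ≤ π), π ⊓ R ∈ subspaceIcc T R := by
          intro π hπ
          exact mem_subspaceIcc.2 ⟨le_inf (Finset.mem_filter.1 hπ).2 hT, inf_le_right⟩
        rw [upSum, ← Finset.sum_fiberwise_of_maps_to hmaps]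
        refine Finset.sum_congr rfl fun S hS => Finset.sum_congr ?_ fun _ _ => rfl
        ext π
        simp only [Finset.mem_filter, and_assoc, and_congr_right_iff, and_iff_right_iff_imp]
        rintro - rfl
        exact (mem_subspaceIcc.1 hS).1.trans inf_le_left
      rw [hf T hT hne] at h1
      have hTm : T ∈ subspaceIcc T R := mem_subspaceIcc.2 ⟨le_rfl, hT⟩
      -- The true fibre sums over `[T, R]` add up to `upSum K f T = 0`, and so do the claimed
      -- values, by the alternating sum of Gaussian binomials. They agree at every `S ≠ T` by
      -- induction, hence also at `T`.
      have h2 := sum_subspaceIcc hT hd (fun e => qmoebius (Nat.card F) e * upSum K f R)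
      have h3 : ∑ e ∈ Finset.range (d + 1), (qbinom (Nat.card F) d e : ℝ) *
          (qmoebius (Nat.card F) e * upSum K f R) = 0 := by
        have := sum_alternating_qbinom (Nat.card F) d hpos.ne'
        have h4 : (∑ e ∈ Finset.range (d + 1), (qmoebius (Nat.card F) e : ℝ) *
            qbinom (Nat.card F) d e) = 0 := by
          exact_mod_cast this
        rw [← zero_mul (upSum K f R), ← h4, Finset.sum_mul]
        refine Finset.sum_congr rfl fun e _ => by ring
      rw [h3, ← Finset.add_sum_erase _ _ hTm] at h2
      rw [← Finset.add_sum_erase _ _ hTm] at h1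
      have h5 : ∑ S ∈ (subspaceIcc T R).erase T,
          ∑ π ∈ (grass F V K).filter (fun π => π ⊓ R = S), f π =
          ∑ S ∈ (subspaceIcc T R).erase T,
            (qmoebius (Nat.card F) (finrank F R - finrank F S) * upSum K f R : ℝ) := by
        refine Finset.sum_congr rfl fun S hS => ?_
        rw [Finset.mem_erase, mem_subspaceIcc] at hS
        have hlt := Submodule.finrank_lt_finrank_of_lt (lt_of_le_of_ne hS.2.1 hS.1.symm)
        have hle := Submodule.finrank_mono hS.2.2
        exact ih (finrank F R - finrank F S) (by omega) hS.2.2 (by omega)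
      rw [h5] at h1
      rw [show finrank F R - finrank F T = d by omega] at h2
      linarith

theorem upSum_adjSum {K i : ℕ} (hi : i ≤ K) (f : Submodule F V → ℝ) (R : Submodule F V) :
    upSum K (adjSum K i f) R = ∑ π ∈ grass F V K, f π *
      meetCount (Nat.card F) (finrank F V) K i (finrank F ↥(π ⊓ R))
        (finrank F R - finrank F ↥(π ⊓ R)) := by
  classical
  simp only [upSum, adjSum, Finset.sum_filter]
  rw [Finset.sum_congr rfl (g := fun π => ∑ π' ∈ grass F V K,
    if R ≤ π ∧ finrank F ↥(π ⊓ π') + i = K then f π' else 0)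
    (fun π _ => by by_cases h : R ≤ π <;> simp [h]), Finset.sum_comm]
  refine Finset.sum_congr rfl fun π' hπ' => ?_
  have hle := Submodule.finrank_mono (inf_le_right : π' ⊓ R ≤ R)
  rw [← Finset.sum_filter, Finset.sum_const, card_meets (t := finrank F ↥(π' ⊓ R)) hi
    (Nat.add_sub_cancel' hle).symm (by rw [inf_comm]) (mem_grass.1 hπ'), nsmul_eq_mul, mul_comm]

/-- In `upSum_adjSum` the weight of `π` depends only on `dim (π ⊓ R)`, and Möbius inversion gives
the sum of `f` over each fibre of `π ↦ π ⊓ R` as a multiple of `upSum K f R`. Thus the relation acts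
triangularly with respect to dimension, with `grassEigen` as its diagonal entries. -/
theorem upSum_adjSum_of_vanishing {K i : ℕ} (hi : i ≤ K) {f : Submodule F V → ℝ}
    {R : Submodule F V} (hf : ∀ S ≤ R, S ≠ R → upSum K f S = 0) :
    upSum K (adjSum K i f) R =
      grassEigen (Nat.card F) (finrank F V) K i (finrank F R) * upSum K f R := by
  classical
  have hmaps : ∀ π ∈ grass F V K, π ⊓ R ∈ subspaceIcc ⊥ R := fun π _ =>
    mem_subspaceIcc.2 ⟨bot_le, inf_le_right⟩
  rw [upSum_adjSum hi, ← Finset.sum_fiberwise_of_maps_to hmaps]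
  obtain ⟨φ, hφ⟩ : ∃ φ : ℕ → ℝ, ∀ e, φ e = qmoebius (Nat.card F) e * upSum K f R *
      meetCount (Nat.card F) (finrank F V) K i (finrank F R - e) e := ⟨_, fun _ => rfl⟩
  have h1 : ∀ S ∈ subspaceIcc ⊥ R, (∑ π ∈ (grass F V K).filter (fun π => π ⊓ R = S), f π *
      (meetCount (Nat.card F) (finrank F V) K i (finrank F ↥(π ⊓ R))
        (finrank F R - finrank F ↥(π ⊓ R)) : ℝ)) =
      φ (finrank F R - finrank F S) := by
    intro S hS
    have hSR := (mem_subspaceIcc.1 hS).2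
    have hle := Submodule.finrank_mono hSR
    rw [hφ, ← sum_inf_eq hf hSR (Nat.add_sub_cancel' hle), Finset.sum_mul]
    refine Finset.sum_congr rfl fun π hπ => ?_
    rw [(Finset.mem_filter.1 hπ).2, Nat.sub_sub_self hle]
  refine (Finset.sum_congr rfl h1).trans
    ((sum_subspaceIcc (bot_le : ⊥ ≤ R) (d := finrank F R) (by simp) φ).trans ?_)
  rw [grassEigen, Int.cast_sum, Finset.sum_mul]
  refine Finset.sum_congr rfl fun e _ => ?_
  rw [hφ]; push_cast; ring

/-- The product of the point–`K`-space incidence relation and the relation of codimension `i`. -/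
theorem adjSum_downSum {K i : ℕ} (hi : i ≤ K) (g : Submodule F V → ℝ) {π : Submodule F V}
    (hπ : finrank F π = K) :
    adjSum K i (downSum g) π =
      grassEigen (Nat.card F) (finrank F V) K i 1 * downSum g π +
        meetCount (Nat.card F) (finrank F V) K i 0 1 * ∑ P ∈ grass F V 1, g P := by
  classical
  -- The count of `π'` through `P` takes one value for `P ≤ π` and another otherwise; their
  -- difference is `grassEigen` at index 1.
  have h1 : ∀ P ∈ grass F V 1, ∑ π' ∈ grass F V K,
      (if finrank F ↥(π ⊓ π') + i = K ∧ P ≤ π' then g P else 0) =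
      grassEigen (Nat.card F) (finrank F V) K i 1 * (if P ≤ π then g P else 0) +
        meetCount (Nat.card F) (finrank F V) K i 0 1 * g P := by
    intro P hP
    rw [mem_grass] at hP
    have hE : (grassEigen (Nat.card F) (finrank F V) K i 1 : ℝ) =
        meetCount (Nat.card F) (finrank F V) K i 1 0 -
          meetCount (Nat.card F) (finrank F V) K i 0 1 := by
      rw [grassEigen, Finset.sum_range_succ, Finset.sum_range_one]
      simp [qmoebius]; ring
    have hset : (grass F V K).filter (fun π' => finrank F ↥(π ⊓ π') + i = K ∧ P ≤ π') =
        (grass F V K).filter fun π' => P ≤ π' ∧ finrank F ↥(π' ⊓ π) + i = K := by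
      refine Finset.filter_congr fun π' _ => ?_
      rw [inf_comm, and_comm]
    rw [← Finset.sum_filter, Finset.sum_const, nsmul_eq_mul, hset]
    split_ifs with h
    · rw [card_meets (t := 1) (d := 0) hi (by rw [hP]) (by rw [inf_eq_left.2 h, hP]) hπ, hE]
      ring
    · have h0 : finrank F ↥(P ⊓ π) = 0 := by
        have hlt := Submodule.finrank_lt_finrank_of_lt
          (lt_of_le_of_ne (inf_le_left : P ⊓ π ≤ P) fun h' => h (inf_eq_left.1 h'))
        omega
      rw [card_meets (t := 0) (d := 1) hi (by rw [hP]) h0 hπ]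
      ring
  simp only [adjSum, downSum, Finset.sum_filter, Finset.mul_sum]
  rw [← Finset.sum_add_distrib, ← Finset.sum_congr rfl h1, Finset.sum_comm]
  refine Finset.sum_congr rfl fun π' _ => ?_
  by_cases h : finrank F ↥(π ⊓ π') + i = K <;> simp [h]

end Operators

/-! ### The eigenvalue of index one differs from those of higher index. -/

section EigenvalueSeparation

/-- The exponent of `q` in the `d`-th summand of `grassEigen`. -/
def eigenExp (i d : ℕ) : ℕ := d.choose 2 + i * (i - d)

theorem eigenExp_succ_lt {i d : ℕ} (h : d < i) : eigenExp i (d + 1) < eigenExp i d := by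
  have h1 : (d + 1).choose 2 = d + d.choose 2 := by
    rw [Nat.choose_succ_succ' d 1, Nat.choose_one_right]
  have h2 : i - d = i - (d + 1) + 1 := by omega
  rw [eigenExp, eigenExp, h1, h2, mul_add]
  omega

theorem eigenExp_lt {i d m : ℕ} (hd : d < m) (hm : m ≤ i) : eigenExp i m < eigenExp i d := by
  induction m, hd using Nat.le_induction with
  | base => exact eigenExp_succ_lt (by omega)
  | succ m hdm ih => exact (eigenExp_succ_lt (by omega)).trans (ih (by omega))

theorem grassEigen_term_eq (q N K i r : ℕ) {d : ℕ} (hd : d ≤ i) :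
    (qbinom q r d * (qmoebius q d * meetCount q N K i (r - d) d) : ℤ) =
      (q : ℤ) ^ eigenExp i d * ((-1) ^ d *
        (qbinom q r d * qbinom q (K - (r - d)) i * qbinom q (N - K - d) (i - d))) := by
  rw [meetCount, if_pos hd, qmoebius, eigenExp, pow_add]
  push_cast; ring

theorem pow_dvd_grassEigen_one (q N K : ℕ) {i : ℕ} (hi : 1 ≤ i) :
    (q : ℤ) ^ eigenExp i 1 ∣ grassEigen q N K i 1 := by
  refine Finset.dvd_sum fun d hd => ?_
  rw [Finset.mem_range] at hd
  rw [grassEigen_term_eq q N K i 1 (by omega)]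
  refine Dvd.dvd.mul_right (pow_dvd_pow _ ?_) _
  rcases Nat.lt_or_ge d 1 with h | h
  · exact (eigenExp_lt h hi).le
  · rw [show d = 1 by omega]

/-- The exponents strictly decrease for `d ≤ i` and the summands with `d > i` vanish, so `d = min r
i` alone has the lowest power of `q`. Its cofactor is, up to sign, a product of Gaussian binomials,
each `1` modulo `q`. Hence the `q`-adic leading term of the eigenvalue is explicit. -/
theorem pow_succ_dvd_grassEigen_sub {q N K i r : ℕ} (hi : i ≤ K) (hr : r ≤ K)
    (hN : 2 * K ≤ N) :
    (q : ℤ) ^ (eigenExp i (min r i) + 1) ∣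
      grassEigen q N K i r - (-1) ^ min r i * (q : ℤ) ^ eigenExp i (min r i) := by
  set m := min r i with hm
  have hmem : m ∈ Finset.range (r + 1) := by rw [Finset.mem_range]; omega
  rw [grassEigen, ← Finset.add_sum_erase _ _ hmem, add_sub_right_comm]
  refine dvd_add ?_ (Finset.dvd_sum fun d hd => ?_)
  · obtain ⟨c1, h1⟩ := exists_qbinom_eq q (show m ≤ r by omega)
    obtain ⟨c2, h2⟩ := exists_qbinom_eq q (show i ≤ K - (r - m) by omega)
    obtain ⟨c3, h3⟩ := exists_qbinom_eq q (show i - m ≤ N - K - m by omega)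
    rw [grassEigen_term_eq q N K i r (by omega), h1, h2, h3]
    refine ⟨(-1) ^ m * (c1 + c2 + c3 + q * (c1 * c2 + c2 * c3 + c1 * c3 + q * (c1 * c2 * c3))), ?_⟩
    push_cast; ring
  · rw [Finset.mem_erase, Finset.mem_range] at hd
    rcases Nat.lt_or_ge i d with h | h
    · simp [meetCount, Nat.not_le.2 h]
    · rw [grassEigen_term_eq q N K i r h]
      exact Dvd.dvd.mul_right (pow_dvd_pow _ (eigenExp_lt (by omega) (by omega))) _

theorem grassEigen_codim_one {q N K r : ℕ} (hr : r ≤ K) :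
    grassEigen q N K 1 r =
      q * qbinom q (N - K) 1 * qbinom q (K - r) 1 - qbinom q r 1 * qbinom q (K - r + 1) 1 := by
  have h0 : (qbinom q r 0 * (qmoebius q 0 * meetCount q N K 1 (r - 0) 0) : ℤ) =
      q * qbinom q (N - K) 1 * qbinom q (K - r) 1 := by
    simp [qmoebius, meetCount]; ring
  cases r with
  | zero => rw [grassEigen, Finset.sum_range_one, h0]; simp
  | succ r =>
    rw [grassEigen, Finset.sum_range_succ', Finset.sum_range_succ', h0, Finset.sum_eq_zero]
    · simp [qmoebius, meetCount, show K - r = K - (r + 1) + 1 by omega]; ring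
    · intro d _
      simp [meetCount]

/-- For `i = 1` the leading exponent is `0` for every `r ≥ 1`, so divisibility separates nothing;
this closed form of the difference shows strict monotonicity instead. -/
theorem grassEigen_codim_one_sub {q N K r s : ℕ} (hr : r ≤ K) (hs : s ≤ r) (hN : 2 * K ≤ N) :
    ((q : ℝ) - 1) ^ 2 * ((grassEigen q N K 1 s : ℝ) - grassEigen q N K 1 r) =
      ((q : ℝ) ^ r - (q : ℝ) ^ s) * ((q : ℝ) ^ (N - r - s + 1) - 1) := by
  obtain ⟨c, rfl⟩ := Nat.exists_eq_add_of_le hs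
  obtain ⟨b, rfl⟩ := Nat.exists_eq_add_of_le hr
  obtain ⟨e, rfl⟩ := Nat.exists_eq_add_of_le hN
  rw [grassEigen_codim_one hr, grassEigen_codim_one (hs.trans hr)]
  rw [show 2 * (s + c + b) + e - (s + c + b) = s + c + b + e by omega,
    show s + c + b - (s + c) = b by omega, show s + c + b - s = c + b by omega,
    show 2 * (s + c + b) + e - (s + c) - s + 1 = c + b + b + e + 1 by omega]
  have h1 := qbinom_one_right q (s + c + b + e)
  have h2 := qbinom_one_right q b
  have h3 := qbinom_one_right q (c + b)
  have h4 := qbinom_one_right q s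
  have h5 := qbinom_one_right q (s + c)
  have h6 := qbinom_one_right q (b + 1)
  have h7 := qbinom_one_right q (c + b + 1)
  push_cast
  calc _ = (q : ℝ) * (qbinom q (s + c + b + e) 1 * (q - 1)) * (qbinom q (c + b) 1 * (q - 1))
        - (qbinom q s 1 * (q - 1)) * (qbinom q (c + b + 1) 1 * (q - 1))
        - q * (qbinom q (s + c + b + e) 1 * (q - 1)) * (qbinom q b 1 * (q - 1))
        + (qbinom q (s + c) 1 * (q - 1)) * (qbinom q (b + 1) 1 * (q - 1)) := by ring
    _ = _ := by rw [h1, h2, h3, h4, h5, h6, h7]; ring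

theorem grassEigen_codim_one_lt {q N K r s : ℕ} (hq : 2 ≤ q) (hr : r ≤ K) (hs : s < r)
    (hN : 2 * K ≤ N) : grassEigen q N K 1 r < grassEigen q N K 1 s := by
  have h := grassEigen_codim_one_sub (q := q) hr hs.le hN
  have hq' : (1 : ℝ) < q := by exact_mod_cast hq
  have h1 : (0 : ℝ) < (q : ℝ) ^ r - (q : ℝ) ^ s := sub_pos.2 (pow_lt_pow_right₀ hq' hs)
  have h2 := q_pow_sub_one_pos hq (Nat.succ_ne_zero (N - r - s))
  have h3 : (0 : ℝ) < ((q : ℝ) - 1) ^ 2 := pow_pos (sub_pos.2 hq') 2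
  have h4 := (pos_iff_pos_of_mul_pos (h ▸ mul_pos h1 h2)).1 h3
  exact_mod_cast sub_pos.1 h4

/-- The eigenvalues on the eigenspaces of index at least two differ from that of index one. -/
theorem grassEigen_ne_grassEigen_one {q N K i r : ℕ} (hq : 2 ≤ q) (hi : 1 ≤ i) (hiK : i ≤ K)
    (hr : 2 ≤ r) (hrK : r ≤ K) (hN : 2 * K ≤ N) :
    grassEigen q N K i r ≠ grassEigen q N K i 1 := by
  rcases Nat.lt_or_ge i 2 with h | h
  · obtain rfl : i = 1 := by omega
    exact (grassEigen_codim_one_lt hq hrK hr hN).ne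
  · intro heq
    have h1 := pow_succ_dvd_grassEigen_sub (q := q) hiK hrK hN
    -- Here `min r i ≥ 2`, so `eigenExp i 1` exceeds the leading exponent at `r`. Equality would
    -- force `q` to divide a unit.
    have h2 : (q : ℤ) ^ (eigenExp i (min r i) + 1) ∣ grassEigen q N K i r := by
      rw [heq]
      exact (pow_dvd_pow _ (eigenExp_lt (m := min r i) (by omega) (by omega))).trans
        (pow_dvd_grassEigen_one q N K hi)
    have h3 := (dvd_sub_right h2).1 h1
    rw [IsUnit.dvd_mul_left ((isUnit_neg_one).pow _), pow_succ] at h3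
    have hpos : (0 : ℤ) < (q : ℤ) ^ eigenExp i (min r i) := by positivity
    have h4 := Int.le_of_dvd hpos h3
    have : (2 : ℤ) ≤ q := by exact_mod_cast hq
    nlinarith

end EigenvalueSeparation

/-- Orthogonal projection of `f` onto the row span of `M`, in coordinates. -/
theorem exists_sub_orthogonal_rows {α β : Type*} [Fintype α] [Fintype β] (M : α → β → ℝ)
    (f : β → ℝ) : ∃ g : α → ℝ, ∀ a, ∑ b, M a b * (f b - ∑ a', M a' b * g a') = 0 := by
  let row : α → EuclideanSpace ℝ β := fun a => WithLp.toLp 2 (M a)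
  obtain ⟨y, hy, z, hz, hyz⟩ := (Submodule.span ℝ (Set.range row)).exists_add_mem_mem_orthogonal
    (WithLp.toLp 2 f : EuclideanSpace ℝ β)
  obtain ⟨g, rfl⟩ := (Submodule.mem_span_range_iff_exists_fun ℝ).1 hy
  refine ⟨g, fun a => ?_⟩
  have h := (Submodule.mem_orthogonal _ _).1 hz (row a) (Submodule.subset_span ⟨a, rfl⟩)
  rw [PiLp.inner_apply] at h
  rw [← h]
  refine Finset.sum_congr rfl fun b _ => ?_
  have hb : f b = (∑ a', g a' • row a') b + z b := by
    rw [← PiLp.add_apply, ← hyz]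
  have hs : (∑ a', g a' • row a') b = ∑ a', M a' b * g a' := by
    simp [row, mul_comm]
  rw [hb, hs]
  simp [row, mul_comm]

/-! ### Eigenvectors that are point sums. -/

section Decomposition

variable {F V : Type*} [Field F] [AddCommGroup V] [Module F V] [Finite V]

/-- `f` agrees on `K`-subspaces with the sum of a point function over the points. -/
def IsPointSum (K : ℕ) (f : Submodule F V → ℝ) : Prop :=
  ∃ g : Submodule F V → ℝ, ∀ π ∈ grass F V K, f π = downSum g π

/-- The maps `downSum` and `upSum` between points and `K`-subspaces are adjoint; hence vanishing
point sums mean orthogonality to all point sums. -/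
theorem sum_mul_downSum (K : ℕ) (f g : Submodule F V → ℝ) :
    ∑ π ∈ grass F V K, f π * downSum g π = ∑ P ∈ grass F V 1, g P * upSum K f P := by
  classical
  simp only [downSum, upSum, Finset.sum_filter, Finset.mul_sum]
  rw [Finset.sum_comm]
  refine Finset.sum_congr rfl fun P _ => Finset.sum_congr rfl fun π _ => ?_
  split_ifs <;> ring

/-- Projection onto the point sums; the incidence matrix is extended by zero to all subspaces. -/
theorem exists_downSum_add (K : ℕ) (f : Submodule F V → ℝ) :
    ∃ g : Submodule F V → ℝ, ∀ P ∈ grass F V 1, upSum K (fun π => f π - downSum g π) P = 0 := by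
  classical
  have := Fintype.ofFinite (Submodule F V)
  obtain ⟨g, hg⟩ := exists_sub_orthogonal_rows (fun P π : Submodule F V =>
    if P ∈ grass F V 1 ∧ π ∈ grass F V K ∧ P ≤ π then (1 : ℝ) else 0) f
  refine ⟨g, fun P hP => ?_⟩
  rw [← hg P, upSum, Finset.sum_filter, ← Finset.sum_subset (Finset.subset_univ (grass F V K))]
  · refine Finset.sum_congr rfl fun π hπ => ?_
    simp only [hP, hπ, true_and]
    split_ifs with h
    · rw [one_mul, downSum, Finset.sum_filter,
        ← Finset.sum_subset (Finset.subset_univ (grass F V 1))]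
      · congr 1
        refine Finset.sum_congr rfl fun Q hQ => ?_
        simp [hQ]
      · intro Q _ hQ
        simp [hQ]
    · rw [zero_mul]
  · intro π _ hπ
    simp [hπ]

theorem adjSum_congr {K : ℕ} (i : ℕ) {f f' : Submodule F V → ℝ}
    (h : ∀ π ∈ grass F V K, f π = f' π) (π : Submodule F V) : adjSum K i f π = adjSum K i f' π := by
  classical
  exact Finset.sum_congr rfl fun π' hπ' => h π' (Finset.mem_filter.1 hπ').1

theorem upSum_congr {K : ℕ} {f f' : Submodule F V → ℝ}
    (h : ∀ π ∈ grass F V K, f π = f' π) (R : Submodule F V) : upSum K f R = upSum K f' R := by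
  classical
  exact Finset.sum_congr rfl fun π' hπ' => h π' (Finset.mem_filter.1 hπ').1

theorem adjSum_add (K i : ℕ) (f f' : Submodule F V → ℝ) (π : Submodule F V) :
    adjSum K i (fun π => f π + f' π) π = adjSum K i f π + adjSum K i f' π :=
  Finset.sum_add_distrib

theorem adjSum_const_mul (K i : ℕ) (c : ℝ) (f : Submodule F V → ℝ) (π : Submodule F V) :
    adjSum K i (fun π => c * f π) π = c * adjSum K i f π :=
  (Finset.mul_sum _ _ _).symm

theorem upSum_sub (K : ℕ) (f f' : Submodule F V → ℝ) (R : Submodule F V) :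
    upSum K (fun π => f π - f' π) R = upSum K f R - upSum K f' R :=
  Finset.sum_sub_distrib ..

theorem upSum_const_mul (K : ℕ) (c : ℝ) (f : Submodule F V → ℝ) (R : Submodule F V) :
    upSum K (fun π => c * f π) R = c * upSum K f R :=
  (Finset.mul_sum _ _ _).symm

theorem downSum_add (g g' : Submodule F V → ℝ) (π : Submodule F V) :
    downSum (fun P => g P + g' P) π = downSum g π + downSum g' π :=
  Finset.sum_add_distrib

theorem downSum_const_mul (c : ℝ) (g : Submodule F V → ℝ) (π : Submodule F V) :
    downSum (fun P => c * g P) π = c * downSum g π :=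
  (Finset.mul_sum _ _ _).symm

variable [Finite F]

theorem downSum_const {K : ℕ} (c : ℝ) {π : Submodule F V} (hπ : finrank F π = K) :
    downSum (fun _ => c) π = qbinom (Nat.card F) K 1 * c := by
  classical
  have h := card_grass_Icc (bot_le : ⊥ ≤ π) (s := 1) (by simp)
  simp only [bot_le, true_and, finrank_bot, Nat.sub_zero, hπ] at h
  rw [downSum, Finset.sum_const, h, nsmul_eq_mul]

theorem isPointSum_const {K : ℕ} (hK : 1 ≤ K) (c : ℝ) :
    IsPointSum K (fun _ : Submodule F V => c) := by
  refine ⟨fun _ => c / qbinom (Nat.card F) K 1, fun π hπ => ?_⟩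
  have : (qbinom (Nat.card F) K 1 : ℝ) ≠ 0 := by
    exact_mod_cast (qbinom_pos _ hK).ne'
  rw [downSum_const _ (mem_grass.1 hπ), mul_div_cancel₀ _ this]

theorem sum_downSum {K : ℕ} (hK : 1 ≤ K) (g : Submodule F V → ℝ) :
    ∑ π ∈ grass F V K, downSum g π =
      qbinom (Nat.card F) (finrank F V - 1) (K - 1) * ∑ P ∈ grass F V 1, g P := by
  classical
  have h := sum_mul_downSum K (fun _ => 1) g
  simp only [one_mul] at h
  rw [h, Finset.mul_sum]
  refine Finset.sum_congr rfl fun P hP => ?_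
  rw [mem_grass] at hP
  have h2 := card_grass_ge P (K := K) (by omega)
  rw [upSum, Finset.sum_const, h2, hP, nsmul_eq_mul, mul_one, mul_comm]

/-- A function with vanishing point sums has vanishing total sum. -/
theorem upSum_bot_eq_zero {K : ℕ} (hK : 1 ≤ K) {f : Submodule F V → ℝ}
    (hf : ∀ P ∈ grass F V 1, upSum K f P = 0) : upSum K f ⊥ = 0 := by
  obtain ⟨g, hg⟩ := isPointSum_const (F := F) (V := V) hK 1
  have h := sum_mul_downSum K f g
  rw [Finset.sum_eq_zero (s := grass F V 1) fun P hP => by rw [hf P hP, mul_zero]] at h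
  rw [upSum_bot, ← h]
  exact Finset.sum_congr rfl fun π hπ => by rw [← hg π hπ, mul_one]

/-- An eigenvector of the relation of codimension `i` whose eigenvalue is not one of those of
index at least two is a sum of point functions. -/
theorem isPointSum_of_adjSum_eq {K i : ℕ} (hK : 1 ≤ K) (hi : i ≤ K) {θ : ℝ}
    (hθ : ∀ r, 2 ≤ r → r ≤ K → (grassEigen (Nat.card F) (finrank F V) K i r : ℝ) ≠ θ)
    {f : Submodule F V → ℝ} (hf : ∀ π ∈ grass F V K, adjSum K i f π = θ * f π) :
    IsPointSum K f := by
  classical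
  obtain ⟨g, hg⟩ := exists_downSum_add K f
  obtain ⟨b, hb⟩ : ∃ b : Submodule F V → ℝ, ∀ π, b π = f π - downSum g π := ⟨_, fun _ => rfl⟩
  simp only [← hb] at hg
  have hbot := upSum_bot_eq_zero hK hg
  obtain ⟨o, ho⟩ := isPointSum_const (F := F) (V := V) hK 1
  -- the defect `adjSum b - θ b` is both a point sum and orthogonal to all point sums
  set z : Submodule F V → ℝ := fun π => adjSum K i b π - θ * b π with hz
  obtain ⟨h, hh⟩ : IsPointSum K z := by
    -- As `f` is an eigenvector, the defect of `b` is minus the defect of `downSum g`. By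
    -- `adjSum_downSum` this is a multiple of `downSum g` plus a constant, and `o` is a point
    -- function whose sum over every `K`-subspace is 1.
    refine ⟨fun P => (θ - grassEigen (Nat.card F) (finrank F V) K i 1) * g P +
      -(meetCount (Nat.card F) (finrank F V) K i 0 1 * ∑ P ∈ grass F V 1, g P) * o P,
      fun π hπ => ?_⟩
    have h1 : adjSum K i f π = adjSum K i b π + adjSum K i (downSum g) π := by
      rw [← adjSum_add]
      congr 1
      funext π
      rw [hb]; ring
    rw [hf π hπ, adjSum_downSum hi g (mem_grass.1 hπ)] at h1
    rw [downSum_add, downSum_const_mul, downSum_const_mul, ← ho π hπ, hz]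
    have := hb π
    dsimp only
    linear_combination (-1 : ℝ) * h1 - θ * this
  have hzP : ∀ P ∈ grass F V 1, upSum K z P = 0 := by
    intro P hP
    rw [hz, upSum_sub, upSum_const_mul, hg P hP, upSum_adjSum_of_vanishing hi, hg P hP]
    · ring
    · intro S hS hne
      have := Submodule.finrank_lt_finrank_of_lt (lt_of_le_of_ne hS hne)
      rw [mem_grass.1 hP] at this
      rw [Submodule.finrank_eq_zero.1 (show finrank F S = 0 by omega), hbot]
  -- Being a point sum and orthogonal to all point sums, `z` is orthogonal to itself.
  have hz0 : ∀ π ∈ grass F V K, z π = 0 := by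
    have h1 := sum_mul_downSum K z h
    rw [Finset.sum_eq_zero (s := grass F V 1) fun P hP => by rw [hzP P hP, mul_zero],
      Finset.sum_congr rfl fun π hπ => by rw [← hh π hπ],
      Finset.sum_eq_zero_iff_of_nonneg fun π _ => mul_self_nonneg _] at h1
    exact fun π hπ => mul_self_eq_zero.1 (h1 π hπ)
  -- So `b` is an eigenvector for `θ`. Once its sums through smaller subspaces vanish, the sum
  -- through `R` is multiplied both by `θ` and by the `r`-th eigenvalue. At `r = K` that sum is `b`
  -- itself.
  have hb0 : ∀ r ≤ K, ∀ R : Submodule F V, finrank F R = r → upSum K b R = 0 := by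
    intro r
    induction r using Nat.strong_induction_on with
    | _ r ih =>
      intro hr R hR
      rcases Nat.lt_or_ge r 2 with h2 | h2
      · interval_cases r
        · rw [Submodule.finrank_eq_zero.1 hR, hbot]
        · exact hg R (mem_grass.2 hR)
      · have h3 := upSum_adjSum_of_vanishing (f := b) (R := R) hi fun S hS hne => by
          have := Submodule.finrank_lt_finrank_of_lt (lt_of_le_of_ne hS hne)
          exact ih _ (by omega) (by omega) S rfl
        rw [upSum_congr (f' := fun π => θ * b π) (fun π hπ => sub_eq_zero.1 (hz0 π hπ)),
          upSum_const_mul, hR] at h3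
        by_contra hne
        exact hθ r h2 hr (mul_right_cancel₀ hne h3).symm
  refine ⟨g, fun π hπ => ?_⟩
  have := hb0 K le_rfl π (mem_grass.1 hπ)
  rw [upSum_self b (mem_grass.1 hπ), hb] at this
  linarith

/-- A point function is determined by its sums over the `K`-subspaces, `2 ≤ K < dim V`. -/
theorem eq_zero_of_downSum_eq_zero {K : ℕ} (hK : 2 ≤ K) (hKV : K < finrank F V)
    {g : Submodule F V → ℝ} (hg : ∀ π ∈ grass F V K, downSum g π = 0) {P : Submodule F V}
    (hP : finrank F P = 1) : g P = 0 := by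
  classical
  set q := Nat.card F with hq
  set N := finrank F V with hN
  have hsum : ∑ Q ∈ grass F V 1, g Q = 0 := by
    have h := sum_downSum (F := F) (V := V) (show 1 ≤ K by omega) g
    rw [Finset.sum_eq_zero hg] at h
    have hne : (qbinom q (N - 1) (K - 1) : ℝ) ≠ 0 := by
      exact_mod_cast (qbinom_pos _ (by omega)).ne'
    exact (mul_eq_zero.1 h.symm).resolve_left hne
  -- There are `[N-2, K-2]` `K`-subspaces through two distinct points; for `Q = P` the Pascal
  -- recursion gives the excess `q^(K-1) [N-2, K-1]`. Since `∑ g = 0`, only this excess times `g P`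
  -- survives.
  have h1 : upSum K (downSum g) P = ∑ Q ∈ grass F V 1, g Q *
      (qbinom q (N - 2) (K - 2) +
        if Q = P then (q : ℝ) ^ (K - 1) * qbinom q (N - 2) (K - 1) else 0) := by
    simp only [upSum, downSum, Finset.sum_filter]
    rw [Finset.sum_congr rfl (g := fun π => ∑ Q ∈ grass F V 1,
      if P ⊔ Q ≤ π then g Q else 0) (fun π _ => by
        by_cases h : P ≤ π <;> simp [h]), Finset.sum_comm]
    refine Finset.sum_congr rfl fun Q hQ => ?_
    rw [mem_grass] at hQ
    rw [← Finset.sum_filter, Finset.sum_const, nsmul_eq_mul, mul_comm]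
    congr 1
    split_ifs with h
    · subst h
      rw [sup_idem, card_grass_ge _ (by omega), hQ, ← hN,
        show N - 1 = N - 2 + 1 by omega, show K - 1 = K - 2 + 1 by omega, qbinom_succ_succ]
      push_cast; rfl
    · have h2 : finrank F ↥(P ⊔ Q) = 2 := by
        have := Submodule.finrank_sup_add_finrank_inf_eq P Q
        have h3 : finrank F ↥(P ⊓ Q) < 1 := by
          rw [← hQ]
          refine Submodule.finrank_lt_finrank_of_lt (lt_of_le_of_ne inf_le_right fun h' => h ?_)
          exact Submodule.eq_of_le_of_finrank_eq (inf_eq_right.1 h') (hQ.trans hP.symm)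
        omega
      rw [card_grass_ge _ (by omega), h2, add_zero]
  have h2 : upSum K (downSum g) P = 0 :=
    Finset.sum_eq_zero fun π hπ => hg π (Finset.mem_filter.1 hπ).1
  rw [h2] at h1
  simp only [mul_add, Finset.sum_add_distrib, ← Finset.sum_mul, hsum, mul_ite, mul_zero,
    Finset.sum_ite_eq', mem_grass, hP, if_true, zero_mul, zero_add] at h1
  have hne : (q : ℝ) ^ (K - 1) * qbinom q (N - 2) (K - 1) ≠ 0 := by
    have h3 := qbinom_pos q (show K - 1 ≤ N - 2 by omega)
    have h4 : 0 < q := by have := two_le_natCard F; omega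
    positivity
  exact (mul_eq_zero.1 h1.symm).resolve_right hne

end Decomposition

/-! ### Averaging over the images of a spread. -/

section Spreads

set_option linter.unusedSectionVars false

variable {F V : Type*} [Field F] [AddCommGroup V] [Module F V] [Finite V]

/-- A finite set of pairwise disjoint `K`-dimensional subspaces covering all points. -/
structure IsLinearSpread (K : ℕ) (S : Finset (Submodule F V)) : Prop where
  finrank_eq : ∀ π ∈ S, finrank F π = K
  disjoint : ∀ π ∈ S, ∀ π' ∈ S, π ≠ π' → Disjoint π π'
  covers : ∀ P : Submodule F V, finrank F P = 1 → ∃ π ∈ S, P ≤ π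

theorem IsLinearSpread.sum_downSum {K : ℕ} {S : Finset (Submodule F V)} (hS : IsLinearSpread K S)
    (g : Submodule F V → ℝ) : ∑ π ∈ S, downSum g π = ∑ P ∈ grass F V 1, g P := by
  classical
  simp only [downSum, Finset.sum_filter]
  rw [Finset.sum_comm]
  refine Finset.sum_congr rfl fun P hP => ?_
  rw [mem_grass] at hP
  obtain ⟨π, hπ, hPπ⟩ := hS.covers P hP
  rw [Finset.sum_eq_single_of_mem π hπ, if_pos hPπ]
  intro π' hπ' hne
  refine if_neg fun h => ?_
  have h1 : P ≤ ⊥ := (hS.disjoint π' hπ' π hπ hne) h hPπ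
  rw [le_bot_iff.1 h1, finrank_bot] at hP
  omega

/-- The automorphism group of `V` acts transitively on embeddings of a given space. -/
theorem exists_linearEquiv_comp_eq {W : Type*} [AddCommGroup W] [Module F W] {a b : W →ₗ[F] V}
    (ha : Function.Injective a) (hb : Function.Injective b) :
    ∃ h : V ≃ₗ[F] V, ∀ w, h (a w) = b w := by
  obtain ⟨h, hh⟩ := Submodule.exists_linearEquiv_restrict_eq
    ((LinearEquiv.ofInjective a ha).symm.trans (LinearEquiv.ofInjective b hb))
  refine ⟨h, fun w => ?_⟩
  have := hh (LinearEquiv.ofInjective a ha w)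
  simpa using this.symm

/-- Disjointness makes `π₁ × π₁' → V` an embedding, so transitivity on embeddings gives transitivity
on ordered pairs of disjoint subspaces. -/
theorem exists_linearEquiv_map_pair {π₁ π₁' π₂ π₂' : Submodule F V}
    (h : finrank F π₁ = finrank F π₂) (h' : finrank F π₁' = finrank F π₂')
    (h₁ : Disjoint π₁ π₁') (h₂ : Disjoint π₂ π₂') :
    ∃ φ : V ≃ₗ[F] V, π₁.map (φ : V →ₗ[F] V) = π₂ ∧ π₁'.map (φ : V →ₗ[F] V) = π₂' := by
  let e := LinearEquiv.ofFinrankEq π₁ π₂ h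
  let e' := LinearEquiv.ofFinrankEq π₁' π₂' h'
  have inj : ∀ {A B : Submodule F V}, Disjoint A B →
      Function.Injective (A.subtype.coprod B.subtype) := by
    intro A B hAB
    rw [← LinearMap.ker_eq_bot, LinearMap.ker_coprod_of_disjoint_range]
    · simp
    · simpa using hAB
  obtain ⟨φ, hφ⟩ := exists_linearEquiv_comp_eq (inj h₁)
    (b := (π₂.subtype.coprod π₂'.subtype).comp (e.prodCongr e').toLinearMap)
    ((inj h₂).comp (e.prodCongr e').injective)
  refine ⟨φ, Submodule.eq_of_le_of_finrank_eq ?_ ?_, Submodule.eq_of_le_of_finrank_eq ?_ ?_⟩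
  · rintro _ ⟨x, hx, rfl⟩
    have := hφ (⟨x, hx⟩, 0)
    simp only [LinearMap.coprod_apply, Submodule.subtype_apply, map_zero, add_zero] at this
    simp [this]
  · rw [← h]; exact LinearEquiv.finrank_map_eq φ π₁
  · rintro _ ⟨x, hx, rfl⟩
    have := hφ (0, ⟨x, hx⟩)
    simp only [LinearMap.coprod_apply, Submodule.subtype_apply, map_zero, zero_add] at this
    simp [this]
  · rw [← h']; exact LinearEquiv.finrank_map_eq φ π₁'

theorem exists_linearEquiv_map {π₁ π₂ : Submodule F V} (h : finrank F π₁ = finrank F π₂) :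
    ∃ φ : V ≃ₗ[F] V, π₁.map (φ : V →ₗ[F] V) = π₂ := by
  obtain ⟨φ, hφ, -⟩ := exists_linearEquiv_map_pair (π₁' := ⊥) (π₂' := ⊥) h (by simp)
    disjoint_bot_right disjoint_bot_right
  exact ⟨φ, hφ⟩

theorem IsLinearSpread.comap {K : ℕ} {S : Finset (Submodule F V)} (hS : IsLinearSpread K S)
    (φ : V ≃ₗ[F] V) {T : Finset (Submodule F V)}
    (hT : ∀ π, π ∈ T ↔ π.comap (φ : V →ₗ[F] V) ∈ S) : IsLinearSpread K T := by
  have hfin : ∀ π : Submodule F V, finrank F (π.comap (φ : V →ₗ[F] V)) = finrank F π := by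
    intro π
    rw [Submodule.comap_equiv_eq_map_symm]
    exact LinearEquiv.finrank_map_eq φ.symm π
  have hmc : ∀ π : Submodule F V, (π.comap (φ : V →ₗ[F] V)).map (φ : V →ₗ[F] V) = π := fun π =>
    Submodule.map_comap_eq_of_surjective φ.surjective π
  refine ⟨fun π hπ => ?_, fun π hπ π' hπ' hne => ?_, fun P hP => ?_⟩
  · rw [← hfin]; exact hS.finrank_eq _ ((hT π).1 hπ)
  · have h := hS.disjoint _ ((hT π).1 hπ) _ ((hT π').1 hπ') fun h => hne (by
      rw [← hmc π, h, hmc])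
    rw [disjoint_iff, ← Submodule.comap_inf] at h
    rw [disjoint_iff, ← hmc (π ⊓ π'), h, Submodule.map_bot]
  · obtain ⟨π, hπ, hle⟩ := hS.covers (P.comap (φ : V →ₗ[F] V)) (by rw [hfin, hP])
    refine ⟨π.map (φ : V →ₗ[F] V), ?_, ?_⟩
    · rw [hT, Submodule.comap_map_eq_of_injective φ.injective]
      exact hπ
    · rw [← hmc P]; exact Submodule.map_mono hle

theorem adjSum_self_eq (K : ℕ) (f : Submodule F V → ℝ) (π : Submodule F V)
    [DecidablePred fun π' => Disjoint π π'] :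
    adjSum K K f π = ∑ π' ∈ (grass F V K).filter (fun π' => Disjoint π π'), f π' := by
  classical
  refine Finset.sum_congr (Finset.filter_congr fun π' _ => ?_) fun _ _ => rfl
  rw [disjoint_iff, ← Submodule.finrank_eq_zero (R := F)]
  omega

/-- A function with constant sums over spreads satisfies an affine equation for the disjointness
relation. -/
theorem exists_adjSum_eq_of_spread {K : ℕ} (hK : 1 ≤ K) (hKV : 2 * K ≤ finrank F V)
    {S₀ : Finset (Submodule F V)} (hS₀ : IsLinearSpread K S₀) :
    ∃ l : ℝ, ∀ (f : Submodule F V → ℝ) (x : ℝ),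
      (∀ S, IsLinearSpread K S → ∑ π ∈ S, f π = x) →
      ∀ π ∈ grass F V K, adjSum K K f π = l * (x - f π) := by
  classical
  have : Finite (V ≃ₗ[F] V) := Finite.of_injective (fun φ => (φ : V → V)) DFunLike.coe_injective
  have := Fintype.ofFinite (V ≃ₗ[F] V)
  -- The number of `φ` whose image `φ(S₀)` contains both arguments. It is `GL(V)`-invariant, so it
  -- takes one value on the diagonal, one on disjoint pairs, and zero on all other pairs.
  set n₂ : Submodule F V → Submodule F V → ℕ := fun π π' =>
    (Finset.univ.filter fun φ : V ≃ₗ[F] V =>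
      π.comap (φ : V →ₗ[F] V) ∈ S₀ ∧ π'.comap (φ : V →ₗ[F] V) ∈ S₀).card with hn₂
  have hinv : ∀ (ψ : V ≃ₗ[F] V) (π π' : Submodule F V),
      n₂ (π.map (ψ : V →ₗ[F] V)) (π'.map (ψ : V →ₗ[F] V)) = n₂ π π' := by
    intro ψ π π'
    have hc : ∀ (π : Submodule F V) (φ : V ≃ₗ[F] V),
        (π.map (ψ : V →ₗ[F] V)).comap ((φ.trans ψ : V ≃ₗ[F] V) : V →ₗ[F] V) =
          π.comap (φ : V →ₗ[F] V) := by
      intro π φ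
      ext v
      simp
    symm
    refine Finset.card_nbij' (fun φ => φ.trans ψ) (fun φ => φ.trans ψ.symm) ?_ ?_ ?_ ?_
    · intro φ hφ
      simp only [Finset.coe_filter, Finset.mem_univ, true_and, Set.mem_ofPred_eq, hc] at hφ ⊢
      exact hφ
    · intro φ hφ
      simp only [Finset.coe_filter, Finset.mem_univ, true_and, Set.mem_ofPred_eq] at hφ ⊢
      have : φ = (φ.trans ψ.symm).trans ψ := by ext; simp
      rw [this, hc, hc] at hφ
      exact hφ
    · intro φ _; ext; simp
    · intro φ _; ext; simp
  obtain ⟨P, hP⟩ : ∃ P : Submodule F V, finrank F P = 1 := by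
    have : Nontrivial V := Module.nontrivial_of_finrank_pos (R := F) (by omega)
    obtain ⟨v, hv⟩ := exists_ne (0 : V)
    exact ⟨_, finrank_span_singleton hv⟩
  obtain ⟨π₀, hπ₀, -⟩ := hS₀.covers P hP
  obtain ⟨π₁, hπ₁, hne⟩ : ∃ π₁ ∈ S₀, π₀ ≠ π₁ := by
    by_contra! h
    have htop : π₀ = ⊤ := by
      rw [eq_top_iff]
      intro v _
      rcases eq_or_ne v 0 with rfl | hv
      · exact π₀.zero_mem
      · obtain ⟨π, hπ, hle⟩ := hS₀.covers _ (finrank_span_singleton hv)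
        rw [h π hπ]
        exact hle (Submodule.mem_span_singleton_self v)
    have := hS₀.finrank_eq π₀ hπ₀
    rw [htop, finrank_top] at this
    omega
  have hd := hS₀.disjoint π₀ hπ₀ π₁ hπ₁ hne
  have hpos : 0 < n₂ π₀ π₁ := Finset.card_pos.2 ⟨LinearEquiv.refl F V, by
    simp only [Finset.mem_filter, Finset.mem_univ, true_and]
    exact ⟨hπ₀, hπ₁⟩⟩
  set T : (V ≃ₗ[F] V) → Finset (Submodule F V) := fun φ =>
    (grass F V K).filter fun π => π.comap (φ : V →ₗ[F] V) ∈ S₀ with hT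
  have hTmem : ∀ φ π, π ∈ T φ ↔ π.comap (φ : V →ₗ[F] V) ∈ S₀ := by
    intro φ π
    rw [hT, Finset.mem_filter, mem_grass, and_iff_right_iff_imp]
    intro h
    rw [← hS₀.finrank_eq _ h, Submodule.comap_equiv_eq_map_symm]
    exact (LinearEquiv.finrank_map_eq φ.symm π).symm
  have hTs : ∀ φ, IsLinearSpread K (T φ) := fun φ => hS₀.comap φ (hTmem φ)
  refine ⟨n₂ π₀ π₀ / n₂ π₀ π₁, fun f x hf π hπ => ?_⟩
  rw [mem_grass] at hπ
  have h1 : n₂ π π = n₂ π₀ π₀ := by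
    obtain ⟨ψ, hψ⟩ := exists_linearEquiv_map ((hS₀.finrank_eq π₀ hπ₀).trans hπ.symm)
    rw [← hinv ψ π₀ π₀, hψ]
  have h2 : ∀ π' : Submodule F V, finrank F π' = K → Disjoint π π' → n₂ π π' = n₂ π₀ π₁ := by
    intro π' hπ' hdis
    obtain ⟨ψ, hψ, hψ'⟩ := exists_linearEquiv_map_pair ((hS₀.finrank_eq π₀ hπ₀).trans hπ.symm)
      ((hS₀.finrank_eq π₁ hπ₁).trans hπ'.symm) hd hdis
    rw [← hinv ψ π₀ π₁, hψ, hψ']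
  have h3 : ∀ π' : Submodule F V, finrank F π' = K → π' ≠ π → ¬ Disjoint π π' → n₂ π π' = 0 := by
    intro π' hπ' hne hnd
    rw [hn₂, Finset.card_eq_zero, Finset.filter_eq_empty_iff]
    rintro φ - ⟨h4, h5⟩
    apply hnd
    exact (hTs φ).disjoint π ((hTmem φ π).2 h4) π' ((hTmem φ π').2 h5) hne.symm
  -- Sum the spread condition over all `φ` with `π ∈ φ(S₀)` and exchange the summations.
  have h4 : ∑ π' ∈ grass F V K, f π' * n₂ π π' = x * n₂ π π := by
    have h5 : ∀ φ : V ≃ₗ[F] V, (∑ π' ∈ grass F V K,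
        if π.comap (φ : V →ₗ[F] V) ∈ S₀ ∧ π'.comap (φ : V →ₗ[F] V) ∈ S₀ then f π' else 0) =
        if π.comap (φ : V →ₗ[F] V) ∈ S₀ ∧ π.comap (φ : V →ₗ[F] V) ∈ S₀ then x else 0 := by
      intro φ
      by_cases h : π.comap (φ : V →ₗ[F] V) ∈ S₀
      · simp only [h, true_and, if_true, ← Finset.sum_filter]
        exact hf _ (hTs φ)
      · simp [h]
    have h6 := Finset.sum_congr (rfl : (Finset.univ : Finset (V ≃ₗ[F] V)) = _) fun φ _ => h5 φ
    rw [Finset.sum_comm, ← Finset.sum_filter, Finset.sum_const, nsmul_eq_mul, mul_comm] at h6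
    rw [← h6]
    refine Finset.sum_congr rfl fun π' _ => ?_
    rw [← Finset.sum_filter, Finset.sum_const, nsmul_eq_mul, mul_comm]
  have h5 : ∑ π' ∈ grass F V K, f π' * n₂ π π' =
      f π * n₂ π₀ π₀ + adjSum K K f π * n₂ π₀ π₁ := by
    rw [← Finset.add_sum_erase _ _ (mem_grass.2 hπ), h1, adjSum_self_eq, Finset.sum_filter,
      Finset.sum_mul]
    rw [← Finset.add_sum_erase (grass F V K) (fun π' => (if Disjoint π π' then f π' else 0) *
      (n₂ π₀ π₁ : ℝ)) (mem_grass.2 hπ),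
      if_neg fun h => by rw [disjoint_self.1 h, finrank_bot] at hπ; omega, zero_mul, zero_add]
    congr 1
    refine Finset.sum_congr rfl fun π' hπ' => ?_
    rw [Finset.mem_erase, mem_grass] at hπ'
    split_ifs with h
    · rw [h2 π' hπ'.2 h]
    · rw [h3 π' hπ'.2 hπ'.1 h]; simp
  rw [h5, h1] at h4
  have : (n₂ π₀ π₁ : ℝ) ≠ 0 := by exact_mod_cast hpos.ne'
  field_simp
  linear_combination h4

end Spreads

/-! ### From affine equations and spread sums to point sums. -/

section SpreadCriterion

set_option linter.unusedSectionVars false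

variable {F V : Type*} [Field F] [Finite F] [AddCommGroup V] [Module F V] [Finite V]

open scoped Classical in
/-- The point function with value `x` at `P` and `0` elsewhere. -/
noncomputable def pointMass (P : Submodule F V) (x : ℝ) : Submodule F V → ℝ :=
  fun Q => if Q = P then x else 0

open scoped Classical in
theorem downSum_pointMass {P : Submodule F V} (hP : finrank F P = 1) (x : ℝ) (π : Submodule F V) :
    downSum (pointMass P x) π = if P ≤ π then x else 0 := by
  simp [downSum, pointMass, Finset.sum_ite_eq', hP]

theorem sum_pointMass {P : Submodule F V} (hP : finrank F P = 1) (x : ℝ) :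
    ∑ Q ∈ grass F V 1, pointMass P x Q = x := by
  classical
  simp [pointMass, hP]

theorem exists_finrank_eq_one (h : 1 ≤ finrank F V) : ∃ P : Submodule F V, finrank F P = 1 := by
  have : Nontrivial V := Module.nontrivial_of_finrank_pos (R := F) h
  obtain ⟨v, hv⟩ := exists_ne (0 : V)
  exact ⟨_, finrank_span_singleton hv⟩

theorem exists_between_finrank {T R : Submodule F V} (hTR : T ≤ R) {s : ℕ} (h1 : finrank F T ≤ s)
    (h2 : s ≤ finrank F R) : ∃ S, T ≤ S ∧ S ≤ R ∧ finrank F S = s := by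
  classical
  have h := card_grass_Icc hTR h1
  have hpos := qbinom_pos (Nat.card F) (show s - finrank F T ≤ finrank F R - finrank F T by omega)
  rw [← h, Finset.card_pos] at hpos
  obtain ⟨S, hS⟩ := hpos
  rw [Finset.mem_filter, mem_grass] at hS
  exact ⟨S, hS.2.1, hS.2.2, hS.1⟩

/-- The affine equation satisfied by point sums characterizes them. -/
theorem isPointSum_of_adjSum_affine {K i : ℕ} (hi : 1 ≤ i) (hiK : i ≤ K)
    (hKV : 2 * K ≤ finrank F V) {f : Submodule F V → ℝ} {x : ℝ}
    (hf : ∀ π ∈ grass F V K, adjSum K i f π =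
      grassEigen (Nat.card F) (finrank F V) K i 1 * f π +
        meetCount (Nat.card F) (finrank F V) K i 0 1 * x) : IsPointSum K f := by
  obtain ⟨P, hP⟩ := exists_finrank_eq_one (F := F) (V := V) (by omega)
  have h := isPointSum_of_adjSum_eq (F := F) (V := V) (K := K) (i := i) (by omega) hiK
    (θ := grassEigen (Nat.card F) (finrank F V) K i 1)
    (fun r hr hrK => by
      exact_mod_cast grassEigen_ne_grassEigen_one (two_le_natCard F) hi hiK hr hrK hKV)
    -- A point sum of total weight `x` solves the same inhomogeneous equation, so the difference is
    -- an eigenvector.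
    (f := fun π => f π + (-1) * downSum (pointMass P x) π) (by
      intro π hπ
      rw [adjSum_add, adjSum_const_mul, hf π hπ, adjSum_downSum hiK _ (mem_grass.1 hπ),
        sum_pointMass hP]
      ring)
  obtain ⟨g, hg⟩ := h
  refine ⟨fun Q => g Q + pointMass P x Q, fun π hπ => ?_⟩
  rw [downSum_add, ← hg π hπ]
  ring

/-- If spreads exist, a function with constant sums over all spreads is a point sum. -/
theorem isPointSum_of_spread {K : ℕ} (hK : 1 ≤ K) (hKV : 2 * K ≤ finrank F V)
    {S₀ : Finset (Submodule F V)} (hS₀ : IsLinearSpread K S₀) {f : Submodule F V → ℝ} {x : ℝ}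
    (hf : ∀ S, IsLinearSpread K S → ∑ π ∈ S, f π = x) : IsPointSum K f := by
  classical
  obtain ⟨l, hl⟩ := exists_adjSum_eq_of_spread hK hKV hS₀
  obtain ⟨P, hP⟩ := exists_finrank_eq_one (F := F) (V := V) (by omega)
  -- The constant `l` is found on a test function: the indicator of the `K`-subspaces through `P`
  -- sums to 1 over every spread. Evaluate it at a `π` missing `P`, taken inside a complement of
  -- `P`.
  have hle : l = meetCount (Nat.card F) (finrank F V) K K 0 1 := by
    obtain ⟨C, hC⟩ := P.exists_isCompl
    have hCf := Submodule.finrank_add_eq_of_isCompl hC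
    obtain ⟨π, -, hπC, hπ⟩ := exists_between_finrank (bot_le : ⊥ ≤ C) (s := K) (by simp) (by omega)
    have hPπ : ¬ P ≤ π := fun h => by
      have h1 : P ≤ ⊥ := hC.disjoint le_rfl (h.trans hπC)
      rw [le_bot_iff.1 h1, finrank_bot] at hP
      omega
    have h1 := hl (downSum (pointMass P 1)) 1
      (fun S hS => by rw [hS.sum_downSum, sum_pointMass hP]) π (mem_grass.2 hπ)
    rw [adjSum_downSum le_rfl _ hπ, sum_pointMass hP, downSum_pointMass hP, if_neg hPπ] at h1
    linarith
  have hE : (grassEigen (Nat.card F) (finrank F V) K K 1 : ℝ) =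
      -meetCount (Nat.card F) (finrank F V) K K 0 1 := by
    rw [grassEigen, Finset.sum_range_succ, Finset.sum_range_one]
    simp [qmoebius, meetCount, qbinom_eq_zero_of_lt _ (show K - 1 < K by omega), hK]
  refine isPointSum_of_adjSum_affine (i := K) (x := x) hK le_rfl hKV fun π hπ => ?_
  rw [hl f x hf π hπ, hE, hle]
  ring

end SpreadCriterion

/-! ### Desarguesian spreads in dimension `2K`. -/

section SpreadExistence

variable {F V : Type*} [Field F] [Finite F] [AddCommGroup V] [Module F V] [Finite V]

theorem exists_field_extension (F : Type*) [Field F] [Finite F] {K : ℕ} (hK : 1 ≤ K) :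
    ∃ (E : Type) (_ : Field E) (_ : Algebra F E), finrank F E = K := by
  obtain ⟨p, hp⟩ := CharP.exists F
  have : Fact p.Prime := ⟨CharP.char_is_prime F p⟩
  have : NeZero K := ⟨by omega⟩
  exact ⟨FiniteField.Extension F p K, inferInstance, inferInstance,
    FiniteField.finrank_extension F p K⟩

/-- The lines over an extension field of degree `K` form a spread. -/
theorem exists_isLinearSpread {K : ℕ} (hK : 1 ≤ K) (hV : finrank F V = 2 * K) :
    ∃ S : Finset (Submodule F V), IsLinearSpread K S := by
  obtain ⟨E, _, _, hE⟩ := exists_field_extension F hK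
  have : Module.Finite F E := Module.finite_of_finrank_pos (by omega)
  have e : V ≃ₗ[F] E × E := LinearEquiv.ofFinrankEq V (E × E) (by
    rw [finrank_prod, hE, hV, two_mul])
  let line : E × E → Submodule F V := fun v =>
    ((Submodule.span E {v}).restrictScalars F).comap (e : V →ₗ[F] E × E)
  have hmem : ∀ u v, u ∈ line v ↔ e u ∈ Submodule.span E {v} := fun u v => Iff.rfl
  have hself : ∀ u, u ∈ line (e u) := fun u => Submodule.mem_span_singleton_self (e u)
  have heq : ∀ u v, u ≠ 0 → u ∈ line v → line (e u) = line v := by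
    intro u v hu h
    rw [hmem, Submodule.mem_span_singleton] at h
    obtain ⟨a, ha⟩ := h
    have ha0 : a ≠ 0 := by
      rintro rfl
      rw [zero_smul] at ha
      exact hu (e.map_eq_zero_iff.1 ha.symm)
    have : Submodule.span E {e u} = Submodule.span E {v} := by
      rw [← ha]
      exact Submodule.span_singleton_smul_eq (IsUnit.mk0 a ha0) v
    ext w
    rw [hmem, hmem, this]
  refine ⟨(Set.toFinite {π | ∃ v, v ≠ 0 ∧ line v = π}).toFinset, ?_, ?_, ?_⟩
  · intro π hπ
    obtain ⟨v, hv, rfl⟩ := (Set.Finite.mem_toFinset _).1 hπ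
    have h1 : finrank F ↥(Submodule.span E {v}) = K := by
      rw [← Module.finrank_mul_finrank F E ↥(Submodule.span E {v}), hE, finrank_span_singleton hv,
        mul_one]
    have h2 : line v = ((Submodule.span E {v}).restrictScalars F).map (e.symm : E × E →ₗ[F] V) :=
      Submodule.comap_equiv_eq_map_symm _ _
    rw [h2]
    exact (LinearEquiv.finrank_map_eq e.symm _).trans h1
  · intro π hπ π' hπ' hne
    obtain ⟨v, hv, rfl⟩ := (Set.Finite.mem_toFinset _).1 hπ
    obtain ⟨v', hv', rfl⟩ := (Set.Finite.mem_toFinset _).1 hπ'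
    rw [Submodule.disjoint_def]
    intro u hu hu'
    by_contra h0
    exact hne ((heq u v h0 hu).symm.trans (heq u v' h0 hu'))
  · intro P hP
    obtain ⟨u, hu, hu0⟩ := P.exists_mem_ne_zero_of_ne_bot (by
      rintro rfl
      rw [finrank_bot] at hP
      omega)
    refine ⟨line (e u), (Set.Finite.mem_toFinset _).2 ⟨e u, ?_, rfl⟩, ?_⟩
    · rwa [Ne, e.map_eq_zero_iff]
    · have : F ∙ u = P := Submodule.eq_of_le_of_finrank_eq
        ((Submodule.span_singleton_le_iff_mem _ _).2 hu) (by rw [finrank_span_singleton hu0, hP])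
      rw [← this, Submodule.span_singleton_le_iff_mem]
      exact hself u

end SpreadExistence

/-! ### Switching invariance: local point functions and their gluing. -/

section Switching

set_option linter.unusedSectionVars false

variable {F V : Type*} [Field F] [Finite F] [AddCommGroup V] [Module F V] [Finite V]

/-- A finite set of pairwise disjoint `K`-dimensional subspaces. -/
structure IsPartialLinearSpread (K : ℕ) (S : Finset (Submodule F V)) : Prop where
  finrank_eq : ∀ π ∈ S, finrank F π = K
  disjoint : ∀ π ∈ S, ∀ π' ∈ S, π ≠ π' → Disjoint π π'

/-- `f` has equal sums over any two disjoint partial spreads covering the same points. -/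
def IsSwitchingInvariant (K : ℕ) (f : Submodule F V → ℝ) : Prop :=
  ∀ R R' : Finset (Submodule F V), IsPartialLinearSpread K R → IsPartialLinearSpread K R' →
    Disjoint R R' →
    (∀ P : Submodule F V, finrank F P = 1 → ((∃ π ∈ R, P ≤ π) ↔ ∃ π ∈ R', P ≤ π)) →
    ∑ π ∈ R, f π = ∑ π ∈ R', f π

theorem IsPartialLinearSpread.sum_downSum_eq {K : ℕ} {S : Finset (Submodule F V)}
    (hS : IsPartialLinearSpread K S) (g : Submodule F V → ℝ)
    [DecidablePred fun P => ∃ π ∈ S, P ≤ π] :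
    ∑ π ∈ S, downSum g π = ∑ P ∈ (grass F V 1).filter (fun P => ∃ π ∈ S, P ≤ π), g P := by
  classical
  simp only [downSum, Finset.sum_filter]
  rw [Finset.sum_comm]
  refine Finset.sum_congr rfl fun P hP => ?_
  rw [mem_grass] at hP
  split_ifs with h
  · obtain ⟨π, hπ, hPπ⟩ := h
    rw [Finset.sum_eq_single_of_mem π hπ, if_pos hPπ]
    intro π' hπ' hne
    refine if_neg fun h => ?_
    have h1 : P ≤ ⊥ := (hS.disjoint π' hπ' π hπ hne) h hPπ
    rw [le_bot_iff.1 h1, finrank_bot] at hP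
    omega
  · push Not at h
    exact Finset.sum_eq_zero fun π hπ => if_neg (h π hπ)

theorem IsPointSum.isSwitchingInvariant {K : ℕ} {f : Submodule F V → ℝ} (hf : IsPointSum K f) :
    IsSwitchingInvariant K f := by
  classical
  obtain ⟨g, hg⟩ := hf
  intro R R' hR hR' _ hcov
  rw [Finset.sum_congr rfl fun π hπ => hg π (mem_grass.2 (hR.finrank_eq π hπ)),
    Finset.sum_congr rfl fun π hπ => hg π (mem_grass.2 (hR'.finrank_eq π hπ)),
    hR.sum_downSum_eq, hR'.sum_downSum_eq]
  exact Finset.sum_congr (Finset.filter_congr fun P hP => hcov P (mem_grass.1 hP)) fun _ _ => rfl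

theorem disjoint_map_subtype {U : Submodule F V} {A B : Submodule F U} (h : Disjoint A B) :
    Disjoint (A.map U.subtype) (B.map U.subtype) := by
  rw [disjoint_iff, ← Submodule.map_inf _ U.injective_subtype, h.eq_bot, Submodule.map_bot]

theorem downSum_map_subtype {U : Submodule F V} (g : Submodule F V → ℝ) (π : Submodule F U) :
    downSum g (π.map U.subtype) = downSum (fun Q => g (Q.map U.subtype)) π := by
  classical
  refine (Finset.sum_nbij' (fun Q : Submodule F U => Q.map U.subtype)
    (fun P : Submodule F V => P.comap U.subtype)
    ?_ ?_ ?_ ?_ fun _ _ => rfl).symm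
  · intro Q hQ
    rw [Finset.mem_filter, mem_grass] at hQ ⊢
    exact ⟨by rw [Submodule.finrank_map_subtype_eq, hQ.1], Submodule.map_mono hQ.2⟩
  · intro P hP
    rw [Finset.mem_filter, mem_grass] at hP ⊢
    refine ⟨?_, ?_⟩
    · rw [(Submodule.comapSubtypeEquivOfLe (hP.2.trans (U.map_subtype_le π))).finrank_eq, hP.1]
    · rw [← Submodule.comap_map_eq_of_injective U.injective_subtype π]
      exact Submodule.comap_mono hP.2
  · intro Q _
    exact Submodule.comap_map_eq_of_injective U.injective_subtype Q
  · intro P hP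
    rw [Finset.mem_filter] at hP
    exact Submodule.map_comap_eq_of_le (by simpa using hP.2.trans (U.map_subtype_le π))

/-- Inside a subspace of dimension `2 K`, a switching invariant function is a point sum. -/
theorem IsSwitchingInvariant.exists_downSum_of_le {K : ℕ} (hK : 1 ≤ K) {f : Submodule F V → ℝ}
    (hf : IsSwitchingInvariant K f) {U : Submodule F V} (hU : finrank F U = 2 * K) :
    ∃ g : Submodule F V → ℝ, ∀ π : Submodule F V, finrank F π = K → π ≤ U → f π = downSum g π := by
  classical
  obtain ⟨S₀, hS₀⟩ := exists_isLinearSpread hK hU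
  have hinj : Function.Injective fun π : Submodule F U => π.map U.subtype :=
    Submodule.map_injective_of_injective U.injective_subtype
  -- Inside `U`, the sets `S \ S₀` and `S₀ \ S` form a conjugate switching pair, and the common
  -- members contribute equally. Hence all spreads of `U` have the same sum.
  have hsw : ∀ S, IsLinearSpread K S →
      ∑ π ∈ S, f (π.map U.subtype) = ∑ π ∈ S₀, f (π.map U.subtype) := by
    intro S hS
    have hps : ∀ A B : Finset (Submodule F U), IsLinearSpread K A →
        IsPartialLinearSpread K ((A \ B).image fun π => π.map U.subtype) := by
      intro A B hA
      refine ⟨?_, ?_⟩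
      · intro π hπ
        obtain ⟨π, hm, rfl⟩ := Finset.mem_image.1 hπ
        rw [Submodule.finrank_map_subtype_eq, hA.finrank_eq π (Finset.mem_sdiff.1 hm).1]
      · intro π hπ π' hπ' hne
        obtain ⟨π, hm, rfl⟩ := Finset.mem_image.1 hπ
        obtain ⟨π', hm', rfl⟩ := Finset.mem_image.1 hπ'
        exact disjoint_map_subtype (hA.disjoint π (Finset.mem_sdiff.1 hm).1 π'
          (Finset.mem_sdiff.1 hm').1 fun h => hne (by rw [h]))
    have hcov : ∀ A B : Finset (Submodule F U), IsLinearSpread K A → IsLinearSpread K B →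
        ∀ P : Submodule F V, finrank F P = 1 →
        (∃ π ∈ (A \ B).image fun π => π.map U.subtype, P ≤ π) →
        ∃ π ∈ (B \ A).image fun π => π.map U.subtype, P ≤ π := by
      rintro A B hA hB P hP ⟨π, hπ, hPπ⟩
      obtain ⟨π, hm, rfl⟩ := Finset.mem_image.1 hπ
      have hPU : P ≤ U := hPπ.trans (U.map_subtype_le π)
      have hP' : finrank F (P.comap U.subtype) = 1 := by
        rw [(Submodule.comapSubtypeEquivOfLe hPU).finrank_eq, hP]
      have hPm : (P.comap U.subtype).map U.subtype = P :=
        Submodule.map_comap_eq_of_le (by simpa using hPU)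
      obtain ⟨π', hπ', hle⟩ := hB.covers _ hP'
      rw [Finset.mem_sdiff] at hm
      refine ⟨π'.map U.subtype, Finset.mem_image.2 ⟨π', Finset.mem_sdiff.2 ⟨hπ', fun h => ?_⟩, rfl⟩,
        by rw [← hPm]; exact Submodule.map_mono hle⟩
      have hPle : P.comap U.subtype ≤ π := by
        rw [← Submodule.comap_map_eq_of_injective U.injective_subtype π]
        exact Submodule.comap_mono hPπ
      have hne : π ≠ π' := fun h' => hm.2 (h' ▸ hπ')
      have h1 : P.comap U.subtype ≤ ⊥ := hA.disjoint π hm.1 π' h hne hPle hle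
      rw [le_bot_iff.1 h1, finrank_bot] at hP'
      omega
    have h1 := hf _ _ (hps S S₀ hS) (hps S₀ S hS₀) (by
        rw [Finset.disjoint_image hinj]
        exact disjoint_sdiff_sdiff)
      fun P hP => ⟨hcov S S₀ hS hS₀ P hP, hcov S₀ S hS₀ hS P hP⟩
    rw [Finset.sum_image fun _ _ _ _ h => hinj h, Finset.sum_image fun _ _ _ _ h => hinj h] at h1
    rw [← Finset.sum_inter_add_sum_sdiff S S₀, h1, Finset.inter_comm,
      Finset.sum_inter_add_sum_sdiff S₀ S]
  obtain ⟨g, hg⟩ := isPointSum_of_spread hK hU.ge hS₀ hsw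
  refine ⟨fun P => g (P.comap U.subtype), fun π hπ hπU => ?_⟩
  have hm : (π.comap U.subtype).map U.subtype = π :=
    Submodule.map_comap_eq_of_le (by simpa using hπU)
  have h1 := hg (π.comap U.subtype) (mem_grass.2 (by
    rw [(Submodule.comapSubtypeEquivOfLe hπU).finrank_eq, hπ]))
  have h2 := downSum_map_subtype (fun P => g (P.comap U.subtype)) (π.comap U.subtype)
  simp only [hm, Submodule.comap_map_eq_of_injective U.injective_subtype] at h1 h2
  exact h1.trans h2.symm

/-- The point functions representing `f` inside a `(K+1)`-dimensional subspace agree there. -/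
theorem eq_of_downSum_eq_of_le {K : ℕ} (hK : 2 ≤ K) {W : Submodule F V}
    (hW : finrank F W = K + 1) {g g' : Submodule F V → ℝ}
    (h : ∀ π : Submodule F V, finrank F π = K → π ≤ W → downSum g π = downSum g' π)
    {P : Submodule F V}
    (hP : finrank F P = 1) (hPW : P ≤ W) : g P = g' P := by
  have h1 := eq_zero_of_downSum_eq_zero (F := F) (V := W) hK (by omega)
    (g := fun Q => g (Q.map W.subtype) + (-1) * g' (Q.map W.subtype)) (fun π hπ => by
      rw [downSum_add, downSum_const_mul, ← downSum_map_subtype, ← downSum_map_subtype,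
        h _ (by rw [Submodule.finrank_map_subtype_eq]; exact mem_grass.1 hπ) (W.map_subtype_le π)]
      ring) (P := P.comap W.subtype)
    (by rw [(Submodule.comapSubtypeEquivOfLe hPW).finrank_eq, hP])
  have hm : (P.comap W.subtype).map W.subtype = P :=
    Submodule.map_comap_eq_of_le (by simpa using hPW)
  rw [hm] at h1
  linarith

/-- For `K ≥ 2` the local functions on two `2K`-dimensional subspaces agree on any common
`(K+1)`-dimensional subspace, by `eq_of_downSum_eq_of_le`. Two `2K`-dimensional subspaces that share
only a point are linked by a chain of such overlaps. The chain needs `3 ≤ K + 1`, so `K = 1`, where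
`K`-subspaces are points, is separate. -/
theorem IsSwitchingInvariant.isPointSum {K : ℕ} (hK : 1 ≤ K) (hKV : 2 * K ≤ finrank F V)
    {f : Submodule F V → ℝ} (hf : IsSwitchingInvariant K f) : IsPointSum K f := by
  classical
  obtain rfl | hK2 : K = 1 ∨ 2 ≤ K := by omega
  · refine ⟨f, fun π hπ => ?_⟩
    rw [mem_grass] at hπ
    have : (grass F V 1).filter (fun P => P ≤ π) = {π} := by
      ext P
      simp only [Finset.mem_filter, mem_grass, Finset.mem_singleton]
      constructor
      · rintro ⟨h1, h2⟩
        exact Submodule.eq_of_le_of_finrank_eq h2 (h1.trans hπ.symm)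
      · rintro rfl
        exact ⟨hπ, le_rfl⟩
    rw [downSum, this, Finset.sum_singleton]
  have hex : ∀ U : Submodule F V, ∃ g : Submodule F V → ℝ, finrank F U = 2 * K →
      ∀ π : Submodule F V, finrank F π = K → π ≤ U → f π = downSum g π := by
    intro U
    by_cases hU : finrank F U = 2 * K
    · obtain ⟨g, hg⟩ := hf.exists_downSum_of_le hK hU
      exact ⟨g, fun _ => hg⟩
    · exact ⟨f, fun h => absurd h hU⟩
  choose G hG using hex
  have hloc : ∀ U U' W P : Submodule F V, finrank F U = 2 * K → finrank F U' = 2 * K →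
      finrank F W = K + 1 → W ≤ U → W ≤ U' → finrank F P = 1 → P ≤ W → G U P = G U' P := by
    intro U U' W P hU hU' hW hWU hWU' hP hPW
    exact eq_of_downSum_eq_of_le hK2 hW (fun π hπ hπW => by
      rw [← hG U hU π hπ (hπW.trans hWU), ← hG U' hU' π hπ (hπW.trans hWU')]) hP hPW
  have hext : ∀ T : Submodule F V, finrank F T ≤ 2 * K → ∃ U, T ≤ U ∧ finrank F U = 2 * K := by
    intro T hT
    obtain ⟨U, h1, -, h2⟩ := exists_between_finrank (le_top : T ≤ ⊤) hT (by rwa [finrank_top])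
    exact ⟨U, h1, h2⟩
  have hglue : ∀ U U' P : Submodule F V, finrank F U = 2 * K → finrank F U' = 2 * K →
      finrank F P = 1 → P ≤ U → P ≤ U' → G U P = G U' P := by
    intro U U' P hU hU' hP hPU hPU'
    -- The chain is `U, Z, Z', U'` with overlaps `Y`, `X`, `Y'` through `P`. As `Y` and `X` share
    -- the 2-dimensional `l`, their join has dimension at most `2(K+1) - 2 = 2K`, and likewise for
    -- `Y'` and `X`.
    obtain ⟨l, hPl, hlU, hl⟩ := exists_between_finrank hPU (s := 2) (by omega) (by omega)
    obtain ⟨l', hPl', hlU', hl'⟩ := exists_between_finrank hPU' (s := 2) (by omega) (by omega)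
    have hll' : finrank F ↥(l ⊔ l') ≤ 3 := by
      have h1 := Submodule.finrank_sup_add_finrank_inf_eq l l'
      have h2 := Submodule.finrank_mono (le_inf hPl hPl')
      omega
    obtain ⟨X, hX, -, hXr⟩ := exists_between_finrank (le_top : l ⊔ l' ≤ ⊤) (s := K + 1) (by omega)
      (by rw [finrank_top]; omega)
    have hjoin : ∀ m Y : Submodule F V, finrank F m = 2 → m ≤ X → m ≤ Y → finrank F Y = K + 1 →
        ∃ Z, Y ⊔ X ≤ Z ∧ finrank F Z = 2 * K := by
      intro m Y hm hmX hmY hY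
      apply hext
      have h1 := Submodule.finrank_sup_add_finrank_inf_eq Y X
      have h2 := Submodule.finrank_mono (le_inf hmY hmX)
      omega
    obtain ⟨Y, hlY, hYU, hY⟩ := exists_between_finrank hlU (s := K + 1) (by omega) (by omega)
    obtain ⟨Y', hlY', hYU', hY'⟩ := exists_between_finrank hlU' (s := K + 1) (by omega) (by omega)
    obtain ⟨Z, hZ, hZr⟩ := hjoin l Y hl (le_sup_left.trans hX) hlY hY
    obtain ⟨Z', hZ', hZr'⟩ := hjoin l' Y' hl' (le_sup_right.trans hX) hlY' hY'
    calc G U P = G Z P := hloc U Z Y P hU hZr hY hYU (le_sup_left.trans hZ) hP (hPl.trans hlY)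
      _ = G Z' P := hloc Z Z' X P hZr hZr' hXr (le_sup_right.trans hZ) (le_sup_right.trans hZ') hP
          (hPl.trans (le_sup_left.trans hX))
      _ = G U' P := hloc Z' U' Y' P hZr' hU' hY' (le_sup_left.trans hZ') hYU' hP (hPl'.trans hlY')
  have hUP : ∀ P : Submodule F V, ∃ U : Submodule F V, finrank F P = 1 →
      P ≤ U ∧ finrank F U = 2 * K := by
    intro P
    by_cases hP : finrank F P = 1
    · obtain ⟨U, hU⟩ := hext P (by omega)
      exact ⟨U, fun _ => hU⟩
    · exact ⟨⊥, fun h => absurd h hP⟩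
  choose A hA using hUP
  refine ⟨fun P => G (A P) P, fun π hπ => ?_⟩
  rw [mem_grass] at hπ
  obtain ⟨U, hπU, hU⟩ := hext π (by omega)
  rw [hG U hU π hπ hπU]
  refine Finset.sum_congr rfl fun P hP => ?_
  rw [Finset.mem_filter, mem_grass] at hP
  exact hglue U (A P) P hU (hA P hP.1).2 hP.1 (hP.2.trans hπU) (hA P hP.1).1

end Switching

/-! ### Dictionary between vectors on `k`-spaces and functions on subspaces. -/

section Translation

set_option linter.unusedSectionVars false

variable {F : Type*} [Field F] [Finite F] {n k : ℕ}

theorem ncard_eq_sum_indicator {α : Type*} [Fintype α] (S : Set α) :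
    (S.ncard : ℝ) = ∑ a, S.indicator (fun _ => (1 : ℝ)) a := by
  classical
  rw [Set.ncard_eq_toFinset_card']
  simp [Set.indicator_apply, Finset.sum_boole]

theorem sum_kSpace (φ : Submodule F (Fin (n + 1) → F) → ℝ) :
    ∑ π : KSpace F n k, φ π.1 = ∑ π ∈ grass F (Fin (n + 1) → F) (k + 1), φ π :=
  (Finset.sum_subtype _ (fun _ => mem_grass) φ).symm

open scoped Classical in
/-- The extension by zero of a vector indexed by the `k`-spaces to all subspaces. -/
noncomputable def extendZero (v : EuclideanSpace ℝ (KSpace F n k)) :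
    Submodule F (Fin (n + 1) → F) → ℝ :=
  fun π => if h : finrank F π = k + 1 then v ⟨π, h⟩ else 0

theorem extendZero_apply (v : EuclideanSpace ℝ (KSpace F n k)) (π : KSpace F n k) :
    extendZero v π.1 = v π := by
  rw [extendZero, dif_pos π.2]

theorem toEuclideanLin_grassmannMatrix (i : ℕ) (v : EuclideanSpace ℝ (KSpace F n k))
    (π : KSpace F n k) :
    Matrix.toEuclideanLin (grassmannMatrix F n k i) v π =
      adjSum (k + 1) i (extendZero v) π.1 := by
  classical
  rw [adjSum, Finset.sum_filter, ← sum_kSpace, Matrix.toLpLin_apply]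
  simp only [Matrix.mulVec, dotProduct, grassmannMatrix, Matrix.of_apply, MeetsInCodim]
  refine Finset.sum_congr rfl fun π' _ => ?_
  rw [extendZero_apply]
  split_ifs with h <;> simp [h]

theorem mem_range_incMatrix_transpose_iff (v : EuclideanSpace ℝ (KSpace F n k)) :
    v ∈ LinearMap.range (Matrix.toEuclideanLin (incMatrix F n k).transpose) ↔
      IsPointSum (k + 1) (extendZero v) := by
  classical
  have key : ∀ (g : Submodule F (Fin (n + 1) → F) → ℝ) (w : EuclideanSpace ℝ (KSpace F n 0)),
      (∀ P : KSpace F n 0, w P = g P.1) → ∀ π : KSpace F n k,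
      Matrix.toEuclideanLin (incMatrix F n k).transpose w π = downSum g π.1 := by
    intro g w hw π
    have h := sum_kSpace (F := F) (n := n) (k := 0) fun P => if P ≤ π.1 then g P else 0
    rw [downSum, Finset.sum_filter]
    refine Eq.trans ?_ h
    rw [Matrix.toLpLin_apply]
    simp only [Matrix.mulVec, dotProduct, incMatrix, Matrix.of_apply, Matrix.transpose_apply]
    refine Finset.sum_congr rfl fun P _ => ?_
    rw [← hw]
    split_ifs <;> simp
  constructor
  · rintro ⟨w, rfl⟩
    refine ⟨extendZero w, fun π hπ => ?_⟩
    have := key (extendZero w) w (fun P => (extendZero_apply w P).symm) ⟨π, mem_grass.1 hπ⟩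
    rw [← this, ← extendZero_apply]
  · rintro ⟨g, hg⟩
    refine ⟨WithLp.toLp 2 fun P => g P.1, ?_⟩
    ext π
    rw [key g _ (fun P => rfl) π, ← hg π.1 (mem_grass.2 π.2), extendZero_apply]

theorem range_toEuclideanLin_transpose {α β : Type*} [Fintype α] [Fintype β] [DecidableEq α]
    [DecidableEq β] (A : Matrix α β ℝ) :
    LinearMap.range (Matrix.toEuclideanLin A.transpose) =
      (LinearMap.ker (Matrix.toEuclideanLin A)).orthogonal := by
  rw [← Submodule.orthogonal_orthogonal (LinearMap.range (Matrix.toEuclideanLin A.transpose))]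
  congr 1
  ext v
  rw [Submodule.mem_orthogonal, LinearMap.mem_ker, ← Matrix.conjTranspose_eq_transpose_of_trivial,
    Matrix.toEuclideanLin_conjTranspose_eq_adjoint]
  constructor
  · intro h
    have := h _ ⟨Matrix.toEuclideanLin A v, rfl⟩
    rwa [LinearMap.adjoint_inner_left, inner_self_eq_zero] at this
  · rintro h _ ⟨w, rfl⟩
    rw [LinearMap.adjoint_inner_left, h, inner_zero_right]

theorem mem_grassmannEigenspace_iff {q : ℕ} (hq : Nat.card F = q) {j : ℕ}
    (v : EuclideanSpace ℝ (KSpace F n k)) :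
    v ∈ grassmannEigenspace F n k j ↔ ∀ i ≤ k + 1, ∀ π : KSpace F n k,
      adjSum (k + 1) i (extendZero v) π.1 = grassmannEigenvalue q n k j i * extendZero v π.1 := by
  subst hq
  simp only [grassmannEigenspace, Submodule.mem_iInf, Finset.mem_range,
    Module.End.mem_eigenspace_iff,
    Nat.lt_succ_iff]
  refine forall₂_congr fun i _ => ?_
  constructor
  · intro h π
    rw [← toEuclideanLin_grassmannMatrix, h, extendZero_apply]
    rfl
  · intro h
    ext π
    rw [toEuclideanLin_grassmannMatrix, h π, extendZero_apply]
    rfl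

theorem isSymmetric_grassmannMatrix (i : ℕ) :
    (Matrix.toEuclideanLin (grassmannMatrix F n k i)).IsSymmetric := by
  rw [Matrix.isSymmetric_toEuclideanLin_iff]
  ext π π'
  have : MeetsInCodim i π' π ↔ MeetsInCodim i π π' := by
    rw [MeetsInCodim, MeetsInCodim, inf_comm]
  by_cases h : MeetsInCodim i π π'
  · simp [grassmannMatrix, h, this.2 h]
  · simp [grassmannMatrix, h, mt this.1 h]

theorem grassmannEigenvalue_zero {q : ℕ} (hq : 2 ≤ q) (hn : 2 * k + 1 ≤ n) {i : ℕ}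
    (hi : i ≤ k + 1) : grassmannEigenvalue q n k 0 i = grassEigen q (n + 1) (k + 1) i 0 := by
  simp only [grassmannEigenvalue, gaussBinom_eq_qbinom hq, grassEigen]
  simp [qmoebius, meetCount, qbinom_symm hq (show i ≤ n - k by omega)]
  ring

theorem grassEigen_one_eq (q N K i : ℕ) :
    grassEigen q N K i 1 = meetCount q N K i 1 0 - meetCount q N K i 0 1 := by
  rw [grassEigen, Finset.sum_range_succ, Finset.sum_range_one]
  simp [qmoebius]; ring

/-- The summand `s` matches `d = 1 - s`. At `i = 0` only `s = 1` occurs and at `i = k + 1` only `s =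
0`; the missing terms are zero in `grassEigen`. -/
theorem grassmannEigenvalue_one {q : ℕ} (hq : 2 ≤ q) (hn : 2 * k + 1 ≤ n) {i : ℕ}
    (hi : i ≤ k + 1) : grassmannEigenvalue q n k 1 i = grassEigen q (n + 1) (k + 1) i 1 := by
  rw [grassEigen_one_eq]
  simp only [grassmannEigenvalue, gaussBinom_eq_qbinom hq]
  obtain rfl | h0 := Nat.eq_zero_or_pos i
  · simp [meetCount]
  have h1 : qbinom q (n - k) (n - k - i) = qbinom q (n - k) i := qbinom_symm hq (by omega)
  have h2 : qbinom q (n - k - 1) (n - k - i) = qbinom q (n - k - 1) (i - 1) := by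
    rw [← qbinom_symm hq (show i - 1 ≤ n - k - 1 by omega)]
    congr 1; omega
  rcases Nat.lt_or_ge k i with h | h
  · obtain rfl : i = k + 1 := by omega
    simp [meetCount, h2, qbinom_eq_zero_of_lt q (Nat.lt_succ_self k)]
    ring
  · rw [show 1 - i = 0 by omega, show min 1 (k + 1 - i) = 1 by omega,
      show Finset.Icc 0 1 = Finset.range 2 from rfl, Finset.sum_range_succ, Finset.sum_range_one]
    simp [meetCount, h1, h2, show 1 ≤ i from h0]
    ring

theorem nonMemberCount_eq {q : ℕ} (hq : 2 ≤ q) {i : ℕ} (hi : 1 ≤ i) (x : ℝ) :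
    nonMemberCount q n k i x = meetCount q (n + 1) (k + 1) i 0 1 * x := by
  rw [nonMemberCount, meetCount, if_pos hi, gaussBinom_eq_qbinom hq, gaussBinom_eq_qbinom hq]
  simp
  ring

theorem memberCount_eq {q : ℕ} (hq : 2 ≤ q) (hn : 2 * k + 1 ≤ n) {i : ℕ} (hi : 1 ≤ i)
    (hik : i ≤ k + 1) (x : ℝ) :
    memberCount q n k i x =
      grassEigen q (n + 1) (k + 1) i 1 + meetCount q (n + 1) (k + 1) i 0 1 * x := by
  obtain ⟨j, rfl⟩ : ∃ j, i = j + 1 := ⟨i - 1, by omega⟩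
  rw [grassEigen_one_eq, memberCount]
  simp only [gaussBinom_eq_qbinom hq, meetCount]
  simp only [Nat.add_sub_cancel, Nat.sub_zero, zero_le, if_true, hi, Nat.add_sub_add_right]
  split_ifs with h
  · have h1 := qbinom_succ_left_mul hq h
    have h2 := qbinom_succ_succ_mul hq (n - k - 1) j
    rw [show n - k - 1 + 1 = n - k by omega] at h2
    rw [show k + 1 - (j + 1) = k - (j + 1) + 1 by omega] at h1
    have h3 := (q_pow_sub_one_pos hq (Nat.succ_ne_zero (k - (j + 1)))).ne'
    have h4 := (q_pow_sub_one_pos hq (Nat.succ_ne_zero j)).ne'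
    rw [Nat.succ_eq_add_one] at h3 h4
    have h5 : ((q : ℝ) ^ (k + 1) - 1) / ((q : ℝ) ^ (k - (j + 1) + 1) - 1) * qbinom q k (j + 1) =
        qbinom q (k + 1) (j + 1) := by
      rw [div_mul_eq_mul_div, ← h1, mul_div_cancel_right₀ _ h3]
    have h6 : ((q : ℝ) ^ (n - k) - 1) / ((q : ℝ) ^ (j + 1) - 1) * qbinom q (n - k - 1) j =
        qbinom q (n - k) (j + 1) := by
      rw [div_mul_eq_mul_div, ← h2, mul_div_cancel_right₀ _ h4]
    push_cast
    rw [← h5, ← h6]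
    ring
  · obtain rfl : j = k := by omega
    rw [qbinom_eq_zero_of_lt q (Nat.lt_succ_self j), qbinom_self]
    push_cast
    ring

end Translation

/-! ### Eigenspaces and switching sets for characteristic vectors. -/

section CameronLiebler

set_option linter.unusedSectionVars false

variable {F : Type*} [Field F] [Finite F] {q n k : ℕ}

theorem extendZero_charVec (L : Set (KSpace F n k)) (π : KSpace F n k) :
    extendZero (charVec L) π.1 = L.indicator (fun _ => (1 : ℝ)) π := by
  rw [extendZero_apply]
  rfl

/-- The finite set of subspaces underlying a set of `k`-spaces. -/
noncomputable def toSubspaces (S : Set (KSpace F n k)) :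
    Finset (Submodule F (Fin (n + 1) → F)) :=
  (Set.toFinite (Subtype.val '' S)).toFinset

theorem mem_toSubspaces {S : Set (KSpace F n k)} {π : Submodule F (Fin (n + 1) → F)} :
    π ∈ toSubspaces S ↔ ∃ π' ∈ S, π'.1 = π := by
  simp only [toSubspaces, Set.Finite.mem_toFinset, Set.mem_image]

theorem val_mem_toSubspaces {S : Set (KSpace F n k)} {π : KSpace F n k} :
    π.1 ∈ toSubspaces S ↔ π ∈ S := by
  rw [mem_toSubspaces]
  exact ⟨fun ⟨π', h, h'⟩ => Subtype.ext h' ▸ h, fun h => ⟨π, h, rfl⟩⟩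

theorem toSubspaces_preimage {T : Finset (Submodule F (Fin (n + 1) → F))}
    (hT : ∀ π ∈ T, finrank F π = k + 1) :
    toSubspaces {π : KSpace F n k | π.1 ∈ T} = T := by
  ext π
  rw [mem_toSubspaces]
  exact ⟨fun ⟨π', h, h'⟩ => h' ▸ h, fun h => ⟨⟨π, hT π h⟩, h, rfl⟩⟩

theorem sum_toSubspaces (L S : Set (KSpace F n k)) :
    ∑ π ∈ toSubspaces S, extendZero (charVec L) π = ((L ∩ S).ncard : ℝ) := by
  classical
  have h1 : toSubspaces S = (grass F (Fin (n + 1) → F) (k + 1)).filter (· ∈ toSubspaces S) := by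
    ext π
    rw [Finset.mem_filter, mem_grass, iff_and_self]
    intro h
    obtain ⟨π', -, rfl⟩ := mem_toSubspaces.1 h
    exact π'.2
  rw [h1, Finset.sum_filter, ← sum_kSpace, ncard_eq_sum_indicator]
  refine Finset.sum_congr rfl fun π _ => ?_
  simp only [extendZero_charVec, val_mem_toSubspaces]
  by_cases hS : π ∈ S <;> by_cases hL : π ∈ L <;> simp [hS, hL]

theorem adjSum_charVec (L : Set (KSpace F n k)) (i : ℕ) (π : KSpace F n k) :
    adjSum (k + 1) i (extendZero (charVec L)) π.1 =
      ({π' ∈ L | MeetsInCodim i π π'}.ncard : ℝ) := by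
  classical
  rw [adjSum, Finset.sum_filter, ← sum_kSpace, ncard_eq_sum_indicator]
  refine Finset.sum_congr rfl fun π' _ => ?_
  rw [extendZero_charVec]
  by_cases h : MeetsInCodim i π π'
  · have h' : finrank F ↥(π.1 ⊓ π'.1) + i = k + 1 := h
    by_cases hL : π' ∈ L <;> simp [h, h', hL]
  · have h' : ¬ finrank F ↥(π.1 ⊓ π'.1) + i = k + 1 := h
    simp [h, h']

theorem disjoint_iff_meetsInCodim (π π' : KSpace F n k) :
    Disjoint π.1 π'.1 ↔ MeetsInCodim (k + 1) π π' := by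
  rw [disjoint_iff, ← Submodule.finrank_eq_zero (R := F), MeetsInCodim]
  omega

theorem isLinearSpread_toSubspaces_iff {S : Set (KSpace F n k)} :
    IsLinearSpread (k + 1) (toSubspaces S) ↔ IsSpread S := by
  constructor
  · intro h
    refine ⟨fun π hπ π' hπ' hne => h.disjoint _ (val_mem_toSubspaces.2 hπ) _
      (val_mem_toSubspaces.2 hπ') fun h' => hne (Subtype.ext h'), ?_⟩
    refine Set.eq_univ_of_forall fun P => ?_
    obtain ⟨π, hπ, hle⟩ := h.covers P.1 P.2
    obtain ⟨π', hπ', rfl⟩ := mem_toSubspaces.1 hπ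
    exact ⟨π', hπ', hle⟩
  · rintro ⟨h1, h2⟩
    refine ⟨?_, ?_, ?_⟩
    · intro π hπ
      obtain ⟨π', -, rfl⟩ := mem_toSubspaces.1 hπ
      exact π'.2
    · intro π hπ π' hπ' hne
      obtain ⟨π, hm, rfl⟩ := mem_toSubspaces.1 hπ
      obtain ⟨π', hm', rfl⟩ := mem_toSubspaces.1 hπ'
      exact h1 hm hm' fun h => hne (by rw [h])
    · intro P hP
      obtain ⟨π, hπ, hle⟩ : (⟨P, hP⟩ : KSpace F n 0) ∈ coveredPoints S := h2 ▸ Set.mem_univ _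
      exact ⟨π.1, val_mem_toSubspaces.2 hπ, hle⟩

theorem isPartialLinearSpread_toSubspaces_iff {S : Set (KSpace F n k)} :
    IsPartialLinearSpread (k + 1) (toSubspaces S) ↔ IsPartialSpread S := by
  constructor
  · intro h π hπ π' hπ' hne
    exact h.disjoint _ (val_mem_toSubspaces.2 hπ) _ (val_mem_toSubspaces.2 hπ')
      fun h' => hne (Subtype.ext h')
  · intro h1
    refine ⟨?_, ?_⟩
    · intro π hπ
      obtain ⟨π', -, rfl⟩ := mem_toSubspaces.1 hπ
      exact π'.2
    · intro π hπ π' hπ' hne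
      obtain ⟨π, hm, rfl⟩ := mem_toSubspaces.1 hπ
      obtain ⟨π', hm', rfl⟩ := mem_toSubspaces.1 hπ'
      exact h1 hm hm' fun h => hne (by rw [h])

theorem mem_coveredPoints_iff {S : Set (KSpace F n k)} (P : KSpace F n 0) :
    P ∈ coveredPoints S ↔ ∃ π ∈ toSubspaces S, P.1 ≤ π := by
  constructor
  · rintro ⟨π, hπ, hle⟩
    exact ⟨π.1, val_mem_toSubspaces.2 hπ, hle⟩
  · rintro ⟨π, hπ, hle⟩
    obtain ⟨π', hπ', rfl⟩ := mem_toSubspaces.1 hπ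
    exact ⟨π', hπ', hle⟩

theorem isSwitchingInvariant_charVec_iff (L : Set (KSpace F n k)) :
    IsSwitchingInvariant (k + 1) (extendZero (charVec L)) ↔
      ∀ R R' : Set (KSpace F n k), IsConjugateSwitchingPair R R' →
        (L ∩ R).ncard = (L ∩ R').ncard := by
  constructor
  · rintro h R R' ⟨h1, h2, h3, h4⟩
    have := h (toSubspaces R) (toSubspaces R') (isPartialLinearSpread_toSubspaces_iff.2 h1)
      (isPartialLinearSpread_toSubspaces_iff.2 h2) (by
        rw [Finset.disjoint_left]
        intro π hπ hπ'
        obtain ⟨π, hm, rfl⟩ := mem_toSubspaces.1 hπ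
        have : π ∈ R ∩ R' := ⟨hm, val_mem_toSubspaces.1 hπ'⟩
        rw [h3] at this
        exact this)
      (fun P hP => by
        have := Set.ext_iff.1 h4 ⟨P, hP⟩
        rwa [mem_coveredPoints_iff, mem_coveredPoints_iff] at this)
    rw [sum_toSubspaces, sum_toSubspaces] at this
    exact_mod_cast this
  · intro h R R' hR hR' hd hcov
    obtain ⟨A, rfl⟩ : ∃ A : Set (KSpace F n k), toSubspaces A = R :=
      ⟨_, toSubspaces_preimage hR.finrank_eq⟩
    obtain ⟨B, rfl⟩ : ∃ B : Set (KSpace F n k), toSubspaces B = R' :=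
      ⟨_, toSubspaces_preimage hR'.finrank_eq⟩
    rw [sum_toSubspaces, sum_toSubspaces, h A B
      ⟨isPartialLinearSpread_toSubspaces_iff.1 hR,
        isPartialLinearSpread_toSubspaces_iff.1 hR', ?_, ?_⟩]
    · refine Set.eq_empty_of_forall_notMem fun π hπ => ?_
      exact Finset.disjoint_left.1 hd (val_mem_toSubspaces.2 hπ.1) (val_mem_toSubspaces.2 hπ.2)
    · ext P
      rw [mem_coveredPoints_iff, mem_coveredPoints_iff]
      exact hcov P.1 P.2

/-- The relations on a point sum of total weight `x`. -/
theorem adjSum_eq_of_isPointSum {f : Submodule F (Fin (n + 1) → F) → ℝ} {x : ℝ}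
    (hq : Nat.card F = q) (hn : 2 * k + 1 ≤ n) (hf : IsPointSum (k + 1) f)
    (hx : ∑ π ∈ grass F (Fin (n + 1) → F) (k + 1), f π = x * qbinom q n k) {i : ℕ}
    (hi : i ≤ k + 1) {π : Submodule F (Fin (n + 1) → F)} (hπ : finrank F π = k + 1) :
    adjSum (k + 1) i f π = grassEigen q (n + 1) (k + 1) i 1 * f π +
      meetCount q (n + 1) (k + 1) i 0 1 * x := by
  subst hq
  obtain ⟨g, hg⟩ := hf
  have hN : finrank F (Fin (n + 1) → F) = n + 1 := by simp
  rw [adjSum_congr i hg, adjSum_downSum hi g hπ, hN, ← hg π (mem_grass.2 hπ)]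
  rw [Finset.sum_congr rfl hg, sum_downSum (by omega), hN, mul_comm x] at hx
  have hne : (qbinom (Nat.card F) n k : ℝ) ≠ 0 := by
    exact_mod_cast (qbinom_pos _ (by omega)).ne'
  rw [mul_left_cancel₀ hne hx]

theorem adjSum_eq_grassEigen_zero {f : Submodule F (Fin (n + 1) → F) → ℝ} {c : ℝ}
    (hq : Nat.card F = q) (hf : ∀ π ∈ grass F (Fin (n + 1) → F) (k + 1), f π = c) {i : ℕ}
    (hi : i ≤ k + 1) {π : Submodule F (Fin (n + 1) → F)} (hπ : finrank F π = k + 1) :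
    adjSum (k + 1) i f π = grassEigen q (n + 1) (k + 1) i 0 * c := by
  classical
  subst hq
  have h := card_meets (R := ⊥) (π' := π) (t := 0) (d := 0) hi (by simp) (by simp) hπ
  simp only [bot_le, true_and] at h
  rw [adjSum_congr i hf, adjSum, Finset.sum_const, nsmul_eq_mul,
    Finset.filter_congr fun π' _ => by rw [inf_comm], h, grassEigen, Finset.sum_range_one]
  simp [qmoebius]

/-- The eigenspaces of index zero and one consist of point sums. -/
theorem grassmannEigenspace_le_range (hq : Nat.card F = q) (hn : 2 * k + 1 ≤ n) {j : ℕ}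
    (hj : j ≤ 1) : grassmannEigenspace F n k j ≤
      LinearMap.range (Matrix.toEuclideanLin (incMatrix F n k).transpose) := by
  intro v hv
  have hq2 : 2 ≤ q := hq ▸ two_le_natCard F
  have hN : finrank F (Fin (n + 1) → F) = n + 1 := by simp
  rw [mem_range_incMatrix_transpose_iff]
  have h := (mem_grassmannEigenspace_iff hq v).1 hv 1 (by omega)
  have he : grassmannEigenvalue q n k j 1 = grassEigen q (n + 1) (k + 1) 1 j := by
    interval_cases j
    · exact grassmannEigenvalue_zero hq2 hn (by omega)
    · exact grassmannEigenvalue_one hq2 hn (by omega)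
  rw [he] at h
  refine isPointSum_of_adjSum_eq (by omega) (by omega) (fun r h2 hr => ?_)
    fun π hπ => h ⟨π, mem_grass.1 hπ⟩
  rw [hN, hq]
  exact_mod_cast (grassEigen_codim_one_lt hq2 hr (show j < r by omega) (by omega)).ne

/-- The symmetric matrix `A_1` has distinct eigenvalues on the two spaces. -/
theorem isOrtho_grassmannEigenspace (hq : Nat.card F = q) (hn : 2 * k + 1 ≤ n) :
    (grassmannEigenspace F n k 0).IsOrtho (grassmannEigenspace F n k 1) := by
  have hq2 : 2 ≤ q := hq ▸ two_le_natCard F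
  rw [Submodule.isOrtho_iff_inner_eq]
  intro u hu v hv
  have hmem : 1 ∈ Finset.range (k + 2) := Finset.mem_range.2 (by omega)
  have hu1 := (Submodule.mem_iInf _).1 ((Submodule.mem_iInf _).1 hu 1) hmem
  have hv1 := (Submodule.mem_iInf _).1 ((Submodule.mem_iInf _).1 hv 1) hmem
  rw [Module.End.mem_eigenspace_iff, hq] at hu1 hv1
  have h := isSymmetric_grassmannMatrix (F := F) (n := n) (k := k) 1 u v
  rw [hu1, hv1, inner_smul_left, inner_smul_right, grassmannEigenvalue_zero hq2 hn (by omega),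
    grassmannEigenvalue_one hq2 hn (by omega)] at h
  have hlt := grassEigen_codim_one_lt hq2 (show 1 ≤ k + 1 by omega) one_pos
    (show 2 * (k + 1) ≤ n + 1 by omega)
  have hne : (grassEigen q (n + 1) (k + 1) 1 0 : ℝ) ≠ grassEigen q (n + 1) (k + 1) 1 1 := by
    exact_mod_cast hlt.ne'
  by_contra h0
  exact hne (mul_right_cancel₀ h0 (by simpa using h))

theorem allOne_mem_grassmannEigenspace (hq : Nat.card F = q) (hn : 2 * k + 1 ≤ n) :
    allOne F n k ∈ grassmannEigenspace F n k 0 := by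
  have hq2 : 2 ≤ q := hq ▸ two_le_natCard F
  rw [mem_grassmannEigenspace_iff hq]
  have h1 : ∀ π : KSpace F n k, extendZero (allOne F n k) π.1 = 1 := fun π => by
    rw [extendZero_apply]; rfl
  intro i hi π
  rw [adjSum_eq_grassEigen_zero hq (fun π hπ => h1 ⟨π, mem_grass.1 hπ⟩) hi π.2, h1,
    grassmannEigenvalue_zero hq2 hn hi]

/-- The relation between the eigenvalues of index zero and one. -/
theorem grassEigen_zero_mul (hq : Nat.card F = q) (hn : 2 * k + 1 ≤ n) {i : ℕ}
    (hi : i ≤ k + 1) :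
    (grassEigen q (n + 1) (k + 1) i 0 : ℝ) * ((q : ℝ) ^ (k + 1) - 1) =
      grassEigen q (n + 1) (k + 1) i 1 * ((q : ℝ) ^ (k + 1) - 1) +
        meetCount q (n + 1) (k + 1) i 0 1 * ((q : ℝ) ^ (n + 1) - 1) := by
  have hq2 : 2 ≤ q := hq ▸ two_le_natCard F
  have hN : finrank F (Fin (n + 1) → F) = n + 1 := by simp
  have hcard : ((grass F (Fin (n + 1) → F) (k + 1)).card : ℝ) = qbinom q (n + 1) (k + 1) := by
    have := card_grass_ge (⊥ : Submodule F (Fin (n + 1) → F)) (K := k + 1) (by simp)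
    simp only [bot_le, Finset.filter_true, finrank_bot, Nat.sub_zero, hN, hq] at this
    rw [this]
  have hs := qbinom_succ_succ_mul hq2 n k
  obtain ⟨π, -, -, hπ⟩ := exists_between_finrank
    (bot_le : (⊥ : Submodule F (Fin (n + 1) → F)) ≤ ⊤) (s := k + 1) (by simp)
    (by rw [finrank_top, hN]; omega)
  -- The constant `c` is evaluated twice, as an eigenvector of index 0 and as a point sum. With this
  -- scaling its total weight is `q^(n+1) - 1`, since `[n+1, k+1] (q^(k+1) - 1) = (q^(n+1) - 1) [n,
  -- k]`.
  set c : ℝ := (q : ℝ) ^ (k + 1) - 1 with hc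
  have h0 := adjSum_eq_grassEigen_zero (f := fun _ => c) hq (fun _ _ => rfl) hi hπ
  have h1 := adjSum_eq_of_isPointSum (f := fun _ => c) (x := (q : ℝ) ^ (n + 1) - 1) hq hn
    (isPointSum_const (by omega) c) (by
      rw [Finset.sum_const, nsmul_eq_mul, hcard, hs]) hi hπ
  rw [← h0, h1]

theorem sub_smul_allOne_mem (hq : Nat.card F = q) (hn : 2 * k + 1 ≤ n)
    {v : EuclideanSpace ℝ (KSpace F n k)} {x : ℝ}
    (hv : ∀ i ≤ k + 1, ∀ π : KSpace F n k, adjSum (k + 1) i (extendZero v) π.1 =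
      grassEigen q (n + 1) (k + 1) i 1 * extendZero v π.1 +
        meetCount q (n + 1) (k + 1) i 0 1 * x) :
    v - (x * (((q : ℝ) ^ (k + 1) - 1) / ((q : ℝ) ^ (n + 1) - 1))) • allOne F n k ∈
      grassmannEigenspace F n k 1 := by
  have hq2 : 2 ≤ q := hq ▸ two_le_natCard F
  have hne := (q_pow_sub_one_pos hq2 (Nat.succ_ne_zero n)).ne'
  rw [Nat.succ_eq_add_one] at hne
  rw [mem_grassmannEigenspace_iff hq]
  set c : ℝ := x * (((q : ℝ) ^ (k + 1) - 1) / ((q : ℝ) ^ (n + 1) - 1)) with hc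
  have h1 : ∀ π : KSpace F n k, extendZero (v - c • allOne F n k) π.1 =
      extendZero v π.1 + (-1) * c := fun π => by
    rw [extendZero_apply, extendZero_apply]
    simp [allOne, sub_eq_add_neg]
  intro i hi π
  rw [adjSum_congr (f' := fun π => extendZero v π + (-1) * c) i
    (fun π hπ => h1 ⟨π, mem_grass.1 hπ⟩), adjSum_add, adjSum_const_mul, hv i hi π,
    adjSum_eq_grassEigen_zero (c := c) hq (fun _ _ => rfl) hi π.2, h1,
    grassmannEigenvalue_one hq2 hn hi]
  have h2 := grassEigen_zero_mul hq hn hi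
  -- The coefficient of the all-one vector is exactly the one cancelling the inhomogeneous term.
  have h3 : grassEigen q (n + 1) (k + 1) i 0 * c = grassEigen q (n + 1) (k + 1) i 1 * c +
      meetCount q (n + 1) (k + 1) i 0 1 * x := by
    rw [hc]
    field_simp
    linear_combination x * h2
  linear_combination -h3

end CameronLiebler

/-! ### The equivalences. -/

theorem mainTheorem1 {F : Type*} [Field F] [Finite F] (q n k : ℕ) (hq : Nat.card F = q)
    (hn : 2 * k + 1 ≤ n) (L : Set (KSpace F n k)) (hL : L.Nonempty) (x : ℝ)
    (hx : (L.ncard : ℝ) = x * gaussBinom q n k) :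
    (∀ i : ℕ, 1 ≤ i → i ≤ k + 1 →
      List.TFAE [
        charVec L ∈ LinearMap.range (Matrix.toEuclideanLin (incMatrix F n k).transpose),
        charVec L ∈ (LinearMap.ker (Matrix.toEuclideanLin (incMatrix F n k))).orthogonal,
        ∀ π : KSpace F n k, ({π' ∈ L | Disjoint π.1 π'.1}.ncard : ℝ) =
          (x - charVec L π) * gaussBinom q (n - k - 1) k * (q : ℝ) ^ (k ^ 2 + k),
        charVec L - (x * (((q : ℝ) ^ (k + 1) - 1) / ((q : ℝ) ^ (n + 1) - 1))) • allOne F n k ∈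
          grassmannEigenspace F n k 1,
        (grassmannEigenspace F n k 0).IsOrtho (grassmannEigenspace F n k 1) ∧
          charVec L ∈ grassmannEigenspace F n k 0 ⊔ grassmannEigenspace F n k 1,
        ∀ π : KSpace F n k,
          (π ∈ L → ({π' ∈ L | MeetsInCodim i π π'}.ncard : ℝ) = memberCount q n k i x) ∧
          (π ∉ L → ({π' ∈ L | MeetsInCodim i π π'}.ncard : ℝ) = nonMemberCount q n k i x),
        ∀ R R' : Set (KSpace F n k), IsConjugateSwitchingPair R R' →
          (L ∩ R).ncard = (L ∩ R').ncard]) ∧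
    ((∃ S : Set (KSpace F n k), IsSpread S) →
      ((∀ S : Set (KSpace F n k), IsSpread S → ((L ∩ S).ncard : ℝ) = x) ↔
        charVec L ∈ LinearMap.range (Matrix.toEuclideanLin (incMatrix F n k).transpose))) := by
  have hq2 : 2 ≤ q := hq ▸ two_le_natCard F
  have hN : Module.finrank F (Fin (n + 1) → F) = n + 1 := by simp
  set f := extendZero (charVec L) with hf
  have hfπ : ∀ π : KSpace F n k, f π.1 = charVec L π := fun π => extendZero_apply _ π
  have hsum : ∑ π ∈ grass F (Fin (n + 1) → F) (k + 1), f π = x * qbinom q n k := by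
    rw [← sum_kSpace, ← gaussBinom_eq_qbinom hq2, ← hx, ncard_eq_sum_indicator]
    exact Finset.sum_congr rfl fun π _ => extendZero_charVec L π
  have hPS := mem_range_incMatrix_transpose_iff (charVec L)
  rw [← hf] at hPS
  -- The affine equation for one fixed relation is already equivalent to being a point sum; property
  -- 6 is this for the given `i`, property 3 for `i = k + 1`.
  have hequiv : ∀ i, 1 ≤ i → i ≤ k + 1 → (IsPointSum (k + 1) f ↔ ∀ π : KSpace F n k,
      ({π' ∈ L | MeetsInCodim i π π'}.ncard : ℝ) =
        grassEigen q (n + 1) (k + 1) i 1 * charVec L π +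
          meetCount q (n + 1) (k + 1) i 0 1 * x) := by
    intro i hi hik
    constructor
    · intro h π
      rw [← adjSum_charVec, ← hfπ]
      exact adjSum_eq_of_isPointSum hq hn h hsum hik π.2
    · intro h
      refine isPointSum_of_adjSum_affine hi hik (by omega) (x := x) fun π hπ => ?_
      rw [hN, hq]
      have := h ⟨π, mem_grass.1 hπ⟩
      rw [← adjSum_charVec, ← hfπ] at this
      exact this
  have hmem : ∀ π ∈ L, charVec L π = 1 := fun π hπ =>
    Set.indicator_of_mem hπ (fun _ => (1 : ℝ))
  have hnmem : ∀ π, π ∉ L → charVec L π = 0 := fun π hπ =>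
    Set.indicator_of_notMem hπ (fun _ => (1 : ℝ))
  have htop : ∀ y : ℝ, grassEigen q (n + 1) (k + 1) (k + 1) 1 * y +
      meetCount q (n + 1) (k + 1) (k + 1) 0 1 * x =
        (x - y) * gaussBinom q (n - k - 1) k * (q : ℝ) ^ (k ^ 2 + k) := by
    intro y
    rw [grassEigen_one_eq, gaussBinom_eq_qbinom hq2]
    simp [meetCount, qbinom_eq_zero_of_lt q (Nat.lt_succ_self k)]
    ring
  refine ⟨fun i hi hik => ?_, ?_⟩
  · tfae_have 1 ↔ 2 := by rw [range_toEuclideanLin_transpose]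
    tfae_have 1 ↔ 3 := by
      rw [hPS, hequiv (k + 1) (by omega) le_rfl]
      simp only [disjoint_iff_meetsInCodim, htop]
    tfae_have 1 → 4 := fun h => sub_smul_allOne_mem hq hn fun i hi π =>
      adjSum_eq_of_isPointSum hq hn (hPS.1 h) hsum hi π.2
    tfae_have 4 → 5 := fun h => ⟨isOrtho_grassmannEigenspace hq hn,
      Submodule.mem_sup.2 ⟨_, Submodule.smul_mem _ _ (allOne_mem_grassmannEigenspace hq hn), _, h,
        add_sub_cancel _ _⟩⟩
    tfae_have 5 → 1 := fun h => sup_le (grassmannEigenspace_le_range hq hn zero_le_one)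
      (grassmannEigenspace_le_range hq hn le_rfl) h.2
    tfae_have 1 ↔ 6 := by
      rw [hPS, hequiv i hi hik]
      refine forall_congr' fun π => ?_
      rw [memberCount_eq hq2 hn hi hik, nonMemberCount_eq hq2 hi]
      by_cases hπ : π ∈ L
      · simp [hπ, hmem π hπ]
      · simp [hπ, hnmem π hπ]
    tfae_have 1 ↔ 7 := by
      rw [hPS, ← isSwitchingInvariant_charVec_iff]
      exact ⟨fun h => h.isSwitchingInvariant,
        fun h => h.isPointSum (by omega) (by omega)⟩
    tfae_finish
  · rintro ⟨S₀, hS₀⟩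
    rw [hPS]
    constructor
    · intro h
      refine isPointSum_of_spread (by omega) (by omega) (isLinearSpread_toSubspaces_iff.2 hS₀)
        (x := x) fun S hS => ?_
      obtain ⟨T, rfl⟩ : ∃ T : Set (KSpace F n k), toSubspaces T = S :=
        ⟨_, toSubspaces_preimage hS.finrank_eq⟩
      rw [sum_toSubspaces]
      exact h T (isLinearSpread_toSubspaces_iff.1 hS)
    · rintro ⟨g, hg⟩ S hS
      have hS' := isLinearSpread_toSubspaces_iff.2 hS
      rw [← sum_toSubspaces, Finset.sum_congr rfl fun π hπ => hg π
        (mem_grass.2 (hS'.finrank_eq π hπ)), hS'.sum_downSum]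
      -- The spread sum is `∑ g`, while the sum over all `k`-spaces is `[n, k] ∑ g = x [n, k]`.
      rw [Finset.sum_congr rfl hg, sum_downSum (by omega), hN, hq, mul_comm x] at hsum
      have hne : (qbinom q n k : ℝ) ≠ 0 := by
        exact_mod_cast (qbinom_pos q (show k ≤ n by omega)).ne'
      exact mul_left_cancel₀ hne hsum
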